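/- Let $n \ge 0$ be an integer, let $E^n$ denote Euclidean $n$-space, and let $\mathrm{Isom}(E^n)$ be its group of isometries, with the compact-open topology. Let $\Gamma$ be an $n$-space group, that is, a discrete subgroup of $\mathrm{Isom}(E^n)$ whose orbit space $E^n/\Gamma = \{\Gamma x : x \in E^n\}$ is compact. Let $\mathrm{Isom}(E^n/\Gamma)$ be the group of isometries of $E^n/\Gamma$ with respect to the orbit space metric $d(\Gamma x, \Gamma y) = \inf\{|x' - y'| : x' \in \Gamma x,\ y' \in \Gamma y\}$. Then the following are equivalent: (1) the group $\mathrm{Isom}(E^n/\Gamma)$ is finite; (2) the center of $\Gamma$ is trivial; (3) the group $\Gamma/[\Gamma,\Gamma]$ is finite. -/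

import Mathlib

/-- Euclidean `n`-space `E^n`. -/
abbrev ESpace (n : ℕ) : Type := EuclideanSpace ℝ (Fin n)

/-- The group `Isom(E^n)` of isometries of Euclidean `n`-space, with composition as product. -/
abbrev IsomE (n : ℕ) : Type := ESpace n ≃ᵢ ESpace n

namespace IsomE

variable {n : ℕ}

/-- An isometry of `E^n` as a continuous self-map of `E^n`. -/
noncomputable def toContinuousMap (γ : IsomE n) : C(ESpace n, ESpace n) := ⟨γ, γ.continuous⟩

/-- `Isom(E^n)` carries the subspace topology inherited from the space `C(E^n, E^n)` of
continuous self-maps of `E^n` with the compact-open topology. -/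
noncomputable instance instTopologicalSpace : TopologicalSpace (IsomE n) :=
  TopologicalSpace.induced toContinuousMap inferInstance

/-- The natural action of `Isom(E^n)` on `E^n`. -/
noncomputable instance instMulAction : MulAction (IsomE n) (ESpace n) where
  smul γ x := γ x
  one_smul _ := rfl
  mul_smul _ _ _ := rfl

theorem smul_def (γ : IsomE n) (x : ESpace n) : γ • x = γ x := rfl

end IsomE

/-- The orbit space `E^n/Γ = {Γx : x ∈ E^n}` of a group `Γ` of isometries of `E^n`. -/
def OrbitSpace {n : ℕ} (Γ : Subgroup (IsomE n)) : Type :=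
  MulAction.orbitRel.Quotient Γ (ESpace n)

namespace OrbitSpace

variable {n : ℕ} {Γ : Subgroup (IsomE n)}

/-- The quotient map `x ↦ Γx`. -/
noncomputable def mk (Γ : Subgroup (IsomE n)) (x : ESpace n) : OrbitSpace Γ :=
  Quotient.mk (MulAction.orbitRel Γ (ESpace n)) x

theorem mk_surjective : Function.Surjective (mk Γ) := Quotient.mk_surjective

theorem mk_eq_mk {x y : ESpace n} : mk Γ x = mk Γ y ↔ ∃ γ ∈ Γ, γ y = x := by
  refine Quotient.eq.trans ?_
  rw [MulAction.orbitRel_apply, MulAction.mem_orbit_iff]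
  exact ⟨fun ⟨γ, h⟩ => ⟨γ.1, γ.2, h⟩, fun ⟨γ, hγ, h⟩ => ⟨⟨γ, hγ⟩, h⟩⟩

/-- The quotient topology on the orbit space. -/
noncomputable instance instTopologicalSpace : TopologicalSpace (OrbitSpace Γ) :=
  TopologicalSpace.coinduced (mk Γ) inferInstance

theorem smul_dist (γ : Γ) (x y : ESpace n) : dist (γ • x) (γ • y) = dist x y :=
  γ.1.dist_eq x y

theorem orbit_nonempty (y : ESpace n) : (MulAction.orbit Γ y).Nonempty :=
  MulAction.nonempty_orbit y

theorem infDist_orbit_le (x x' y : ESpace n) (γ : Γ) (h : γ • x' = x) :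
    Metric.infDist x (MulAction.orbit Γ y) ≤ Metric.infDist x' (MulAction.orbit Γ y) := by
  refine (Metric.le_infDist (orbit_nonempty y)).2 ?_
  rintro _ ⟨δ, rfl⟩
  have hmem : γ • (δ • y) ∈ MulAction.orbit Γ y := ⟨γ * δ, mul_smul _ _ _⟩
  refine (Metric.infDist_le_dist_of_mem hmem).trans ?_
  rw [← h, smul_dist]

/-- The orbit space distance function: `dist (Γx) (Γy)` is the infimum of the distances between
points of `Γx` and points of `Γy`, which is the distance from `x` to the orbit `Γy`. -/
noncomputable instance instDist : Dist (OrbitSpace Γ) where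
  dist p q := Quotient.liftOn₂ p q (fun x y => Metric.infDist x (MulAction.orbit Γ y)) (by
    rintro x y x' y' ⟨γ, hγ⟩ hy
    have hy' : MulAction.orbit Γ y = MulAction.orbit Γ y' := MulAction.orbit_eq_iff.2 hy
    simp only [hy']
    refine le_antisymm (infDist_orbit_le x x' y' γ hγ) (infDist_orbit_le x' x y' γ⁻¹ ?_)
    rw [← hγ]
    exact inv_smul_smul γ x')

theorem dist_mk (x y : ESpace n) :
    dist (mk Γ x) (mk Γ y) = Metric.infDist x (MulAction.orbit Γ y) := rfl

theorem dist_mk_lt_iff {x y : ESpace n} {r : ℝ} :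
    dist (mk Γ x) (mk Γ y) < r ↔ ∃ γ : Γ, dist x (γ • y) < r := by
  rw [dist_mk, Metric.infDist_lt_iff (orbit_nonempty y)]
  exact ⟨fun ⟨_, ⟨γ, h⟩, h'⟩ => ⟨γ, by rw [← h] at h'; exact h'⟩, fun ⟨γ, h⟩ => ⟨_, ⟨γ, rfl⟩, h⟩⟩

theorem mk_smul (γ : Γ) (y : ESpace n) : mk Γ (γ • y) = mk Γ y :=
  mk_eq_mk.2 ⟨γ.1, γ.2, rfl⟩

theorem dist_mk_comm_le (x y : ESpace n) : dist (mk Γ x) (mk Γ y) ≤ dist (mk Γ y) (mk Γ x) := by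
  refine le_of_forall_gt fun r hr => ?_
  obtain ⟨γ, h⟩ := dist_mk_lt_iff.1 hr
  refine dist_mk_lt_iff.2 ⟨γ⁻¹, ?_⟩
  rwa [← smul_dist γ, smul_inv_smul, dist_comm]

/-- The orbit space pseudometric. For a discrete group `Γ` it is a metric. -/
noncomputable abbrev pseudoMetric (Γ : Subgroup (IsomE n)) : PseudoMetricSpace (OrbitSpace Γ) where
  dist := dist
  dist_self p := by
    obtain ⟨x, rfl⟩ := mk_surjective p
    exact Metric.infDist_zero_of_mem (MulAction.mem_orbit_self x)
  dist_comm p q := by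
    obtain ⟨x, rfl⟩ := mk_surjective p
    obtain ⟨y, rfl⟩ := mk_surjective q
    exact le_antisymm (dist_mk_comm_le x y) (dist_mk_comm_le y x)
  dist_triangle p q r := by
    obtain ⟨x, rfl⟩ := mk_surjective p
    obtain ⟨y, rfl⟩ := mk_surjective q
    obtain ⟨z, rfl⟩ := mk_surjective r
    refine le_of_forall_pos_lt_add fun ε hε => ?_
    obtain ⟨γ, h⟩ := dist_mk_lt_iff.1 (lt_add_of_pos_right (dist (mk Γ x) (mk Γ y)) (half_pos hε))
    obtain ⟨δ, h'⟩ := dist_mk_lt_iff.1 (lt_add_of_pos_right (dist (mk Γ y) (mk Γ z)) (half_pos hε))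
    have h1 : dist (mk Γ x) (mk Γ z) ≤ dist x ((γ * δ) • z) :=
      Metric.infDist_le_dist_of_mem ⟨γ * δ, rfl⟩
    have h2 := dist_triangle x (γ • y) ((γ * δ) • z)
    rw [mul_smul, smul_dist] at h2
    rw [mul_smul] at h1
    linarith

/-- The quotient topology is the topology of the orbit space metric. -/
theorem topology_eq : (instTopologicalSpace : TopologicalSpace (OrbitSpace Γ)) =
    (pseudoMetric Γ).toUniformSpace.toTopologicalSpace := by
  refine TopologicalSpace.ext_iff.2 fun U => ?_
  rw [isOpen_coinduced, Metric.isOpen_iff]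
  let := pseudoMetric Γ
  refine Iff.trans ?_ (Metric.isOpen_iff (s := U)).symm
  constructor
  · intro h p hp
    obtain ⟨x, rfl⟩ := mk_surjective p
    obtain ⟨ε, hε, hb⟩ := h x hp
    refine ⟨ε, hε, fun q hq => ?_⟩
    obtain ⟨y, rfl⟩ := mk_surjective q
    obtain ⟨γ, hγ⟩ := dist_mk_lt_iff.1 ((dist_comm _ _).trans_lt (Metric.mem_ball.1 hq))
    rw [← mk_smul γ y]
    exact hb (Metric.mem_ball'.2 hγ)
  · intro h x hx
    obtain ⟨ε, hε, hb⟩ := h (mk Γ x) hx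
    refine ⟨ε, hε, fun y hy => hb (Metric.mem_ball.2 (dist_mk_lt_iff.2 ⟨1, ?_⟩))⟩
    rw [one_smul]
    exact Metric.mem_ball.1 hy

/-- The orbit space with the orbit space metric, whose topology is the quotient topology. -/
noncomputable instance instPseudoMetricSpace : PseudoMetricSpace (OrbitSpace Γ) :=
  (pseudoMetric Γ).replaceTopology topology_eq

end OrbitSpace

/-- An `n`-space group (`n`-dimensional crystallographic group) is a discrete group of isometries
of `E^n` whose orbit space is compact. -/
structure IsSpaceGroup {n : ℕ} (Γ : Subgroup (IsomE n)) : Prop where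
  discrete : DiscreteTopology Γ
  compact : CompactSpace (OrbitSpace Γ)

/-- The group `Isom(E^n/Γ)` of isometries of the orbit space `E^n/Γ`. -/
abbrev IsomOrbitSpace {n : ℕ} (Γ : Subgroup (IsomE n)) : Type :=
  OrbitSpace Γ ≃ᵢ OrbitSpace Γ

open Filter Topology
open scoped commutatorElement

/-! ### Finite approximation in totally bounded families -/

/-! All three conditions are linked through the vectors fixed by every linear part of `Γ`. If `v` is
such a vector, the translations by `t • v` commute with `Γ` and descend to isometries of the orbit
space. Discreteness makes infinitely many of these distinct when `v ≠ 0`, so (1) forces `v = 0`. A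
central element has bounded displacement by cocompactness, hence is a translation by a fixed vector,
and (2) follows.

For (2) → (3), Bieberbach's argument shows that the translations form an abelian normal subgroup of
finite index: iterated commutators with a small rotation part shrink to `1`, so elements with small
rotation parts commute and, by cocompactness, are translations (`commutator_eq_one_of_small`,
`linPart_eq_one_of_small`). The product of the conjugates of a translation over the cosets is
central, hence trivial, so every translation has finite order in the abelianization. As `Γ` is
finitely generated, the abelianization is finite.

For (3) → (1), pairing `γ 0` with a fixed vector gives a homomorphism to `ℝ`, which must vanish;
cocompactness then leaves no nonzero fixed vector. An isometry of the orbit space near the identity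
lifts near a regular point to an isometry `g` of Euclidean space. Comparing Dirichlet cells, `g`
conjugates `Γ` into itself (`le_of_voronoi_eq`, `conj_mem_of_local_lift`). Being nearly `1`, it
commutes with a finite generating set, so it is a translation by a fixed vector, hence `1`. Thus the
identity is isolated among the isometries of a compact space, and there are only finitely many. -/

theorem exists_finite_approx {ι M : Type*} [PseudoMetricSpace M] (f : ι → M)
    (hf : TotallyBounded (Set.range f)) {δ : ℝ} (hδ : 0 < δ) :
    ∃ F : Set ι, F.Finite ∧ ∀ i, ∃ j ∈ F, dist (f i) (f j) < δ := by
  obtain ⟨t, hts, htf, ht⟩ := Metric.finite_approx_of_totallyBounded hf δ hδ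
  rcases isEmpty_or_nonempty ι with _ | _
  · exact ⟨∅, Set.finite_empty, fun i => isEmptyElim i⟩
  choose! g hg using fun y (hy : y ∈ t) => hts hy
  refine ⟨g '' t, htf.image g, fun i => ?_⟩
  obtain ⟨y, hy, hi⟩ := Set.mem_iUnion₂.1 (ht (Set.mem_range_self i))
  exact ⟨g y, Set.mem_image_of_mem g hy, by rw [hg y hy]; exact hi⟩

/-- The source of every compactness finiteness below: for bounded pieces of `Γ`, for its cosets
modulo translations, and for the isometries of the orbit space. -/
theorem finite_of_separated {ι M : Type*} [PseudoMetricSpace M] (f : ι → M)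
    (hf : TotallyBounded (Set.range f)) {δ : ℝ} (hδ : 0 < δ)
    (hs : ∀ i j, dist (f i) (f j) < δ → i = j) : Finite ι := by
  obtain ⟨F, hF, h⟩ := exists_finite_approx f hf hδ
  refine Set.finite_univ_iff.1 (hF.subset fun i _ => ?_)
  obtain ⟨j, hj, hij⟩ := h i
  rwa [hs i j hij]

namespace IsomE

variable {n : ℕ}

/-! ### The linear part of an isometry -/

/-- The linear part `A` of an isometry `x ↦ A x + a`. -/
noncomputable def linPart : IsomE n →* (ESpace n →L[ℝ] ESpace n) where
  toFun γ := (γ.toRealAffineIsometryEquiv.linearIsometryEquiv.toContinuousLinearEquiv :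
    ESpace n →L[ℝ] ESpace n)
  map_one' := by
    ext1 x
    have := (IsometryEquiv.toRealAffineIsometryEquiv (1 : IsomE n)).map_vadd 0 x
    simpa using this.symm
  map_mul' γ δ := by
    ext1 x
    have h := (IsometryEquiv.toRealAffineIsometryEquiv (γ * δ)).map_vadd 0 x
    have h1 := (IsometryEquiv.toRealAffineIsometryEquiv δ).map_vadd 0 x
    have h2 := (IsometryEquiv.toRealAffineIsometryEquiv γ).map_vadd (δ 0)
      (δ.toRealAffineIsometryEquiv.linearIsometryEquiv x)
    simp only [IsometryEquiv.coeFn_toRealAffineIsometryEquiv, vadd_eq_add, add_zero,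
      IsometryEquiv.mul_apply] at h h1 h2
    rw [h1, h2] at h
    exact (add_right_cancel h).symm

theorem apply_eq (γ : IsomE n) (x : ESpace n) : γ x = linPart γ x + γ 0 := by
  have h := (IsometryEquiv.toRealAffineIsometryEquiv γ).map_vadd 0 x
  simp only [IsometryEquiv.coeFn_toRealAffineIsometryEquiv, vadd_eq_add, add_zero] at h
  exact h

theorem apply_sub (γ : IsomE n) (x y : ESpace n) : γ x - γ y = linPart γ (x - y) := by
  rw [apply_eq γ x, apply_eq γ y, map_sub]; abel

theorem apply_add (γ : IsomE n) (x v : ESpace n) : γ (x + v) = γ x + linPart γ v := by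
  rw [apply_eq γ (x + v), apply_eq γ x, map_add]; abel

theorem norm_linPart_apply (γ : IsomE n) (x : ESpace n) : ‖linPart γ x‖ = ‖x‖ := by
  have := γ.dist_eq x 0
  rwa [dist_eq_norm, apply_sub, sub_zero, dist_zero_right] at this

theorem inner_linPart (γ : IsomE n) (x y : ESpace n) :
    inner ℝ (linPart γ x) (linPart γ y) = inner ℝ x y :=
  LinearIsometry.inner_map_map ⟨(linPart γ : ESpace n →ₗ[ℝ] ESpace n), norm_linPart_apply γ⟩ x y

theorem norm_linPart_le (γ : IsomE n) : ‖linPart γ‖ ≤ 1 :=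
  ContinuousLinearMap.opNorm_le_bound _ zero_le_one fun x => by
    rw [norm_linPart_apply, one_mul]

theorem norm_linPart_mul (γ : IsomE n) (T : ESpace n →L[ℝ] ESpace n) :
    ‖linPart γ * T‖ = ‖T‖ := by
  refine le_antisymm ?_ ?_
  · exact (norm_mul_le _ _).trans (mul_le_of_le_one_left (norm_nonneg _) (norm_linPart_le γ))
  · have h : linPart γ⁻¹ * (linPart γ * T) = T := by
      rw [← mul_assoc, ← map_mul, inv_mul_cancel, map_one, one_mul]
    conv_lhs => rw [← h]
    exact (norm_mul_le _ _).trans (mul_le_of_le_one_left (norm_nonneg _) (norm_linPart_le _))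

theorem norm_mul_linPart (γ : IsomE n) (T : ESpace n →L[ℝ] ESpace n) :
    ‖T * linPart γ‖ = ‖T‖ := by
  refine le_antisymm ?_ ?_
  · exact (norm_mul_le _ _).trans (mul_le_of_le_one_right (norm_nonneg _) (norm_linPart_le γ))
  · have h : (T * linPart γ) * linPart γ⁻¹ = T := by
      rw [mul_assoc, ← map_mul, mul_inv_cancel, map_one, mul_one]
    conv_lhs => rw [← h]
    exact (norm_mul_le _ _).trans (mul_le_of_le_one_right (norm_nonneg _) (norm_linPart_le _))

theorem ext_linPart {γ δ : IsomE n} (h : linPart γ = linPart δ) (h0 : γ 0 = δ 0) : γ = δ := by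
  ext1 x
  rw [apply_eq γ, apply_eq δ, h, h0]

theorem eq_one_of_linPart {γ : IsomE n} (h : linPart γ = 1) (h0 : γ 0 = 0) : γ = 1 :=
  ext_linPart (by rw [h, map_one]) h0

theorem inv_apply_apply (γ : IsomE n) (x : ESpace n) : γ⁻¹ (γ x) = x := γ.symm_apply_apply x

theorem apply_inv_apply (γ : IsomE n) (x : ESpace n) : γ (γ⁻¹ x) = x := γ.apply_symm_apply x

theorem mul_apply (γ δ : IsomE n) (x : ESpace n) : (γ * δ) x = γ (δ x) := rfl

theorem dist_apply_right (γ : IsomE n) (x y : ESpace n) : dist x (γ y) = dist (γ⁻¹ x) y := by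
  rw [← γ.dist_eq (γ⁻¹ x) y, apply_inv_apply]

/-- An isometry with bounded displacement is a translation. -/
theorem linPart_eq_one_of_bounded {g : IsomE n} {C : ℝ} (h : ∀ x, dist (g x) x ≤ C) :
    linPart g = 1 := by
  ext1 x
  by_contra hne
  have hpos : 0 < ‖linPart g x - x‖ := norm_pos_iff.2 (sub_ne_zero.2 hne)
  obtain ⟨k, hk⟩ := exists_nat_gt ((C + ‖g 0‖) / ‖linPart g x - x‖)
  rw [div_lt_iff₀ hpos] at hk
  have h1 := h ((k : ℝ) • x)
  rw [dist_eq_norm, apply_eq, map_smul] at h1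
  have h2 : (k : ℝ) • (linPart g x - x)
      = ((k : ℝ) • linPart g x + g 0 - (k : ℝ) • x) - g 0 := by rw [smul_sub]; abel
  have h3 := norm_sub_le ((k : ℝ) • linPart g x + g 0 - (k : ℝ) • x) (g 0)
  rw [← h2, norm_smul, Real.norm_natCast] at h3
  linarith

/-! ### Discrete groups of isometries -/

variable {Γ : Subgroup (IsomE n)}

theorem continuous_affine : Continuous fun p : (ESpace n →L[ℝ] ESpace n) × ESpace n =>
    (⟨fun x => p.1 x + p.2, by fun_prop⟩ : C(ESpace n, ESpace n)) := by
  refine ContinuousMap.continuous_of_continuous_uncurry _ ?_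
  change Continuous fun q : ((ESpace n →L[ℝ] ESpace n) × ESpace n) × ESpace n =>
    q.1.1 q.2 + q.1.2
  fun_prop

/-- An affine map depends continuously on its linear part and translation part, so compact-open
neighbourhoods of `1` can be tested by two norms. -/
theorem exists_linPart_lt_subset {U : Set (IsomE n)} (hU : U ∈ 𝓝 (1 : IsomE n)) :
    ∃ δ > 0, ∀ γ : IsomE n, ‖linPart γ - 1‖ < δ → ‖γ 0‖ < δ → γ ∈ U := by
  rw [nhds_induced, mem_comap] at hU
  obtain ⟨t, ht, htU⟩ := hU
  have h1 : (toContinuousMap (1 : IsomE n)) =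
      (⟨fun x => (1 : ESpace n →L[ℝ] ESpace n) x + 0, by fun_prop⟩ : C(ESpace n, ESpace n)) := by
    ext1 x
    simp [toContinuousMap]
  rw [h1] at ht
  obtain ⟨δ, hδ, hb⟩ := Metric.mem_nhds_iff.1
    ((continuous_affine (n := n)).continuousAt (x := (1, 0)) ht)
  refine ⟨δ, hδ, fun γ hA ha => htU ?_⟩
  have : ((linPart γ, γ 0) : (ESpace n →L[ℝ] ESpace n) × ESpace n) ∈ Metric.ball (1, 0) δ := by
    rw [Metric.mem_ball, Prod.dist_eq, max_lt_iff]
    exact ⟨by rwa [dist_eq_norm], by rwa [dist_zero_right]⟩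
  have h2 := hb this
  have h3 : toContinuousMap γ = (⟨fun x => linPart γ x + γ 0, by fun_prop⟩ :
      C(ESpace n, ESpace n)) := by
    ext1 x
    exact apply_eq γ x
  rw [Set.mem_preimage, h3]
  exact h2

theorem exists_isolation (h : DiscreteTopology Γ) :
    ∃ δ > 0, ∀ γ ∈ Γ, ‖linPart γ - 1‖ < δ → ‖γ 0‖ < δ → γ = 1 := by
  have h1 : ({1} : Set Γ) ∈ 𝓝 (1 : Γ) := (isOpen_discrete _).mem_nhds rfl
  rw [nhds_induced, mem_comap] at h1
  obtain ⟨U, hU, hsub⟩ := h1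
  obtain ⟨δ, hδ, hb⟩ := exists_linPart_lt_subset hU
  refine ⟨δ, hδ, fun γ hγ hA ha => ?_⟩
  have : (⟨γ, hγ⟩ : Γ) ∈ ({1} : Set Γ) := hsub (hb γ hA ha)
  exact congrArg Subtype.val this

/-- Left translation preserves both norms, so isolation of `1` makes all of `Γ` uniformly separated,
while the pairs of linear and translation parts stay in a compact ball. -/
theorem finite_norm_apply_zero_le (h : DiscreteTopology Γ) (C : ℝ) :
    {γ | γ ∈ Γ ∧ ‖γ 0‖ ≤ C}.Finite := by
  obtain ⟨δ, hδ, hiso⟩ := exists_isolation h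
  let f : {γ | γ ∈ Γ ∧ ‖γ 0‖ ≤ C} → (ESpace n →L[ℝ] ESpace n) × ESpace n :=
    fun γ => (linPart γ.1, γ.1 0)
  refine Set.finite_coe_iff.1 ?_
  refine finite_of_separated f ?_ hδ ?_
  · refine (isCompact_closedBall 0 (max 1 C)).totallyBounded.subset ?_
    rintro _ ⟨γ, rfl⟩
    rw [mem_closedBall_zero_iff, Prod.norm_def]
    exact max_le_max (norm_linPart_le _) γ.2.2
  · rintro ⟨α, hα, _⟩ ⟨β, hβ, _⟩ hd
    rw [Prod.dist_eq, max_lt_iff, dist_eq_norm, dist_eq_norm] at hd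
    have h1 : β⁻¹ * α = 1 := by
      refine hiso _ (Γ.mul_mem (Γ.inv_mem hβ) hα) ?_ ?_
      · rw [← norm_linPart_mul β, mul_sub, ← map_mul, mul_inv_cancel_left, mul_one]
        exact hd.1
      · rw [← dist_zero_right, ← β.dist_eq, ← mul_apply, mul_inv_cancel_left, dist_eq_norm]
        exact hd.2
    exact Subtype.ext (inv_mul_eq_one.1 h1).symm

theorem finite_dist_apply_le (h : DiscreteTopology Γ) (z x : ESpace n) (C : ℝ) :
    {γ | γ ∈ Γ ∧ dist z (γ x) ≤ C}.Finite := by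
  refine (finite_norm_apply_zero_le h (C + ‖z‖ + ‖x‖)).subset fun γ hγ => ⟨hγ.1, ?_⟩
  have h1 := dist_triangle4 (γ 0) (γ x) z 0
  rw [γ.dist_eq, dist_comm (γ x) z, dist_zero_right, dist_zero_right, dist_zero_left] at h1
  linarith [hγ.2]

theorem countable_of_discrete (h : DiscreteTopology Γ) : (Γ : Set (IsomE n)).Countable := by
  refine (Set.countable_iUnion fun k : ℕ => (finite_norm_apply_zero_le h k).countable).mono ?_
  intro γ hγ
  obtain ⟨k, hk⟩ := exists_nat_ge ‖γ 0‖
  exact Set.mem_iUnion.2 ⟨k, hγ, hk⟩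

end IsomE

/-! ### Small rotation parts -/

/-- With `X = D ^ m - 1`, squaring gives `D ^ (2 * m) - 1 = 2 X + X * X`, so the distance to `1`
grows by a factor of at least `2 - c > 1` at each squaring unless it is zero. -/
theorem eq_one_of_norm_pow_sub_one_le {R : Type*} [NormedRing R] [NormedAlgebra ℝ R] {D : R}
    {c : ℝ} (hc : c < 1) (h : ∀ m : ℕ, ‖D ^ m - 1‖ ≤ c) : D = 1 := by
  by_contra hne
  have hpos : 0 < ‖D - 1‖ := norm_pos_iff.2 (sub_ne_zero.2 hne)
  have hgrow : ∀ k : ℕ, (2 - c) ^ k * ‖D - 1‖ ≤ ‖D ^ 2 ^ k - 1‖ := by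
    intro k
    induction k with
    | zero => simp
    | succ k ih =>
      have hXc := h (2 ^ k)
      set X := D ^ 2 ^ k - 1 with hX
      have h1 : (2 : ℝ) • X = (D ^ 2 ^ (k + 1) - 1) - X * X := by
        have : D ^ 2 ^ (k + 1) = (X + 1) * (X + 1) := by
          rw [hX, sub_add_cancel, ← pow_add, pow_succ, mul_two]
        rw [this, two_smul]
        noncomm_ring
      have h2 : 2 * ‖X‖ ≤ ‖D ^ 2 ^ (k + 1) - 1‖ + c * ‖X‖ := by
        have := norm_sub_le (D ^ 2 ^ (k + 1) - 1) (X * X)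
        rw [← h1, norm_smul, Real.norm_ofNat] at this
        have h4 := (norm_mul_le X X).trans (mul_le_mul_of_nonneg_right hXc (norm_nonneg X))
        linarith
      have h3 := mul_le_mul_of_nonneg_left ih (show 0 ≤ 2 - c by linarith)
      rw [pow_succ]
      linarith
  obtain ⟨k, hk⟩ := (tendsto_pow_atTop_atTop_of_one_lt (show 1 < 2 - c by linarith)).eventually
    (eventually_gt_atTop (c / ‖D - 1‖)) |>.exists
  rw [div_lt_iff₀ hpos] at hk
  linarith [hgrow k, h (2 ^ k)]

namespace IsomE

variable {n : ℕ} {Γ : Subgroup (IsomE n)}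

theorem linPart_commutator_sub_one (α β : IsomE n) :
    ‖linPart ⁅α, β⁆ - 1‖ = ‖linPart α * linPart β - linPart β * linPart α‖ := by
  have h : ⁅α, β⁆ * (β * α) = α * β := by rw [commutatorElement_def]; group
  rw [← norm_mul_linPart (β * α), sub_mul, ← map_mul, h, one_mul, map_mul, map_mul]

theorem norm_linPart_commutator_le (α β : IsomE n) :
    ‖linPart ⁅α, β⁆ - 1‖ ≤ 2 * ‖linPart α - 1‖ * ‖linPart β - 1‖ := by
  rw [linPart_commutator_sub_one]
  have : linPart α * linPart β - linPart β * linPart α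
    = (linPart α - 1) * (linPart β - 1) - (linPart β - 1) * (linPart α - 1) := by
    simp only [mul_sub, sub_mul, mul_one, one_mul]; abel
  rw [this]
  refine (norm_sub_le _ _).trans ?_
  have h1 := norm_mul_le (linPart α - 1) (linPart β - 1)
  have h2 := norm_mul_le (linPart β - 1) (linPart α - 1)
  linarith

theorem norm_linPart_commutator_le_right (α β : IsomE n) :
    ‖linPart ⁅α, β⁆ - 1‖ ≤ 2 * ‖linPart β - 1‖ := by
  rw [linPart_commutator_sub_one]
  have : linPart α * linPart β - linPart β * linPart α
    = linPart α * (linPart β - 1) - (linPart β - 1) * linPart α := by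
    simp only [mul_sub, sub_mul, mul_one, one_mul]; abel
  rw [this]
  refine (norm_sub_le _ _).trans ?_
  rw [norm_linPart_mul, norm_mul_linPart, two_mul]

theorem linPart_commutator_eq_one_iff (α β : IsomE n) :
    linPart ⁅α, β⁆ = 1 ↔ Commute (linPart α) (linPart β) := by
  rw [← sub_eq_zero, ← norm_eq_zero, linPart_commutator_sub_one, norm_eq_zero, sub_eq_zero]
  rfl

/-- If a rotation `A` commutes with `[B, A]` and `B` is close to `1` then `A` commutes with `B`. -/
theorem linPart_commutator_eq_one_of_commute {α β : IsomE n}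
    (h : Commute (linPart ⁅β, α⁆) (linPart α)) (hβ : ‖linPart β - 1‖ ≤ 1 / 4) :
    linPart ⁅β, α⁆ = 1 := by
  refine eq_one_of_norm_pow_sub_one_le (c := 1 / 2) (by norm_num) fun m => ?_
  -- Commutation turns the powers of `[B, A]` into `[B, A ^ m]`. These stay within `2 ‖B - 1‖ ≤ 1 /
  -- 2` of `1`, whatever `A ^ m` is.
  have h1 : linPart ⁅β, α⁆ ^ m * linPart (α ^ m) = linPart (β * α ^ m * β⁻¹) := by
    rw [map_pow, ← h.mul_pow, ← conj_pow, map_pow, ← map_mul, commutatorElement_def]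
    congr 2
    group
  have h2 : linPart ⁅β, α⁆ ^ m = linPart ⁅β, α ^ m⁆ := by
    rw [commutatorElement_def β (α ^ m), map_mul _ _ (α ^ m)⁻¹, ← h1, mul_assoc, ← map_mul,
      mul_inv_cancel, map_one, mul_one]
  rw [h2, linPart_commutator_sub_one, norm_sub_rev, ← linPart_commutator_sub_one]
  refine (norm_linPart_commutator_le_right _ _).trans ?_
  linarith

theorem norm_commutator_apply_zero_le (α β : IsomE n) :
    ‖⁅α, β⁆ 0‖ ≤ 2 * ‖linPart α - 1‖ * ‖linPart β - 1‖ * (‖α 0‖ + ‖β 0‖)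
      + ‖linPart α - 1‖ * ‖β 0‖ + ‖linPart β - 1‖ * ‖α 0‖ := by
  -- This is the point that `β * α` sends to `0`, so the commutator at `0` becomes the difference `α
  -- (β w) - β (α w)`.
  set w := α⁻¹ (β⁻¹ 0) with hw
  have hβα : β (α w) = 0 := by rw [hw, apply_inv_apply, apply_inv_apply]
  have hnw : ‖w‖ ≤ ‖α 0‖ + ‖β 0‖ := by
    rw [← dist_zero_right, ← α.dist_eq, ← β.dist_eq, hβα]
    have := dist_triangle 0 (β 0) (β (α 0))
    rw [β.dist_eq, dist_zero_left (β 0), dist_zero_left (α 0)] at this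
    linarith
  have h1 : ⁅α, β⁆ 0 = α (β w) - β (α w) := by
    rw [hβα, sub_zero]; rfl
  have h2 : α (β w) - β (α w) = (linPart α * linPart β - linPart β * linPart α) w
      + (linPart α - 1) (β 0) - (linPart β - 1) (α 0) := by
    rw [apply_eq α (β w), apply_eq β (α w), apply_eq α w, apply_eq β w]
    simp only [map_add, sub_apply, mul_apply_eq_comp, one_apply_eq_self]
    abel
  rw [h1, h2]
  refine (norm_sub_le _ _).trans (add_le_add ((norm_add_le _ _).trans (add_le_add ?_ ?_)) ?_)
  · refine (ContinuousLinearMap.le_opNorm _ _).trans ?_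
    rw [← linPart_commutator_sub_one]
    gcongr
    exact norm_linPart_commutator_le α β
  · exact ContinuousLinearMap.le_opNorm _ _
  · exact ContinuousLinearMap.le_opNorm _ _

theorem norm_linPart_sub_one_le (α : IsomE n) : ‖linPart α - 1‖ ≤ 2 := by
  have h := norm_linPart_le α
  have h1 := norm_linPart_le (1 : IsomE n)
  rw [map_one] at h1
  linarith [norm_sub_le (linPart α) 1]

theorem commutator_mem {α β : IsomE n} (hα : α ∈ Γ) (hβ : β ∈ Γ) : ⁅α, β⁆ ∈ Γ :=
  Γ.mul_mem (Γ.mul_mem (Γ.mul_mem hα hβ) (Γ.inv_mem hα)) (Γ.inv_mem hβ)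

/-- Commutation with `α` contracts rotation parts, and then the translation parts decay
geometrically too; discreteness leaves only `1` in the end. -/
theorem iterate_commutator_eq_one (h : DiscreteTopology Γ) {α β : IsomE n} (hα : α ∈ Γ)
    (hβ : β ∈ Γ) (hs : ‖linPart α - 1‖ ≤ 1 / 8) : ∃ k : ℕ, (fun γ => ⁅α, γ⁆)^[k] β = 1 := by
  set c : ℕ → IsomE n := fun k => (fun γ => ⁅α, γ⁆)^[k] β with hc
  have hsucc : ∀ k, c (k + 1) = ⁅α, c k⁆ := fun k => Function.iterate_succ_apply' _ _ _
  have hmem : ∀ k, c k ∈ Γ := by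
    intro k
    induction k with
    | zero => exact hβ
    | succ k ih => rw [hsucc]; exact commutator_mem hα ih
  have hr : ∀ k, ‖linPart (c k) - 1‖ ≤ 2 * (1 / 4) ^ k := by
    intro k
    induction k with
    | zero => simpa using norm_linPart_sub_one_le _
    | succ k ih =>
      rw [hsucc, pow_succ]
      refine (norm_linPart_commutator_le _ _).trans ?_
      have := norm_nonneg (linPart (c k) - 1)
      nlinarith
  -- Writing `t k` for the left side, the estimates give `t (k + 1) ≤ 5/8 * t k + 5/2 * (3/4) ^ k *
  -- ‖α 0‖`. The rate `3/4` exceeds `5/8`, and `40` absorbs the inhomogeneous term.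
  have ht : ∀ k, ‖c k 0‖ ≤ (‖β 0‖ + 40 * ‖α 0‖) * (3 / 4) ^ k := by
    intro k
    induction k with
    | zero =>
      have := norm_nonneg (α 0)
      simp only [pow_zero, mul_one]
      change ‖β 0‖ ≤ _
      linarith
    | succ k ih =>
      rw [hsucc]
      refine (norm_commutator_apply_zero_le _ _).trans ?_
      have hrk := hr k
      have hr2 := norm_linPart_sub_one_le (c k)
      have h14 : ((1 : ℝ) / 4) ^ k ≤ (3 / 4) ^ k := by gcongr; norm_num
      set s := ‖linPart α - 1‖
      set r := ‖linPart (c k) - 1‖ with hrdef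
      set t := ‖c k 0‖
      set a := ‖α 0‖
      set q : ℝ := (3 / 4) ^ k with hq
      have ha : 0 ≤ a := norm_nonneg _
      have hb : 0 ≤ ‖β 0‖ := norm_nonneg _
      have ht0 : 0 ≤ t := norm_nonneg _
      have hr0 : 0 ≤ r := norm_nonneg _
      have hs0 : 0 ≤ s := norm_nonneg _
      have hq0 : 0 ≤ q := by positivity
      have hrq : r ≤ 2 * q := by linarith
      have e1 : 2 * s * r * (a + t) ≤ 1 / 4 * r * a + 1 / 2 * t := by
        have : s * r ≤ 1 / 8 * r := mul_le_mul_of_nonneg_right hs hr0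
        have h5 : 2 * s * r * (a + t) ≤ 1 / 4 * r * (a + t) :=
          mul_le_mul_of_nonneg_right (by linarith) (by positivity)
        have h6 : r * t ≤ 2 * t := mul_le_mul_of_nonneg_right hr2 ht0
        linarith
      have e2 : s * t ≤ 1 / 8 * t := mul_le_mul_of_nonneg_right hs ht0
      have e3 : r * a ≤ 2 * q * a := mul_le_mul_of_nonneg_right hrq ha
      have e4 : 0 ≤ q * a := mul_nonneg hq0 ha
      have e5 : 0 ≤ ‖β 0‖ * q := mul_nonneg hb hq0
      rw [pow_succ, ← hq]
      linarith
  obtain ⟨δ, hδ, hiso⟩ := exists_isolation h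
  have l1 : Tendsto (fun k : ℕ => 2 * ((1 : ℝ) / 4) ^ k) atTop (𝓝 0) := by
    simpa using (tendsto_pow_atTop_nhds_zero_of_lt_one (r := (1 : ℝ) / 4) (by norm_num)
      (by norm_num)).const_mul 2
  have l2 : Tendsto (fun k : ℕ => (‖β 0‖ + 40 * ‖α 0‖) * ((3 : ℝ) / 4) ^ k) atTop (𝓝 0) := by
    simpa using (tendsto_pow_atTop_nhds_zero_of_lt_one (r := (3 : ℝ) / 4) (by norm_num)
      (by norm_num)).const_mul (‖β 0‖ + 40 * ‖α 0‖)
  obtain ⟨k, hk1, hk2⟩ := ((l1.eventually (gt_mem_nhds hδ)).and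
    (l2.eventually (gt_mem_nhds hδ))).exists
  exact ⟨k, hiso _ (hmem k) ((hr k).trans_lt hk1) ((ht k).trans_lt hk2)⟩

/-- Peel off one commutator at a time: by induction `A` commutes with `[A, B]`, hence with its
inverse `[B, A]`, and the power argument above makes that trivial. -/
theorem linPart_commutator_eq_one_of_iterate {α : IsomE n} (hα : ‖linPart α - 1‖ ≤ 1 / 8) :
    ∀ (k : ℕ) {β : IsomE n}, ‖linPart β - 1‖ ≤ 1 / 8 →
      (fun γ => ⁅α, γ⁆)^[k] β = 1 → linPart ⁅α, β⁆ = 1 := by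
  intro k
  induction k with
  | zero =>
    rintro β - rfl
    rw [commutatorElement_one_right, map_one]
  | succ k ih =>
    intro β hβ h
    rw [Function.iterate_succ_apply] at h
    have hsmall : ‖linPart ⁅α, β⁆ - 1‖ ≤ 1 / 8 := by
      refine (norm_linPart_commutator_le α β).trans ?_
      nlinarith [norm_nonneg (linPart α - 1), norm_nonneg (linPart β - 1)]
    have h1 := (linPart_commutator_eq_one_iff _ _).1 (ih hsmall h)
    have h2 : linPart ⁅β, α⁆ * linPart ⁅α, β⁆ = 1 := by
      rw [← map_mul, ← commutatorElement_inv α β, inv_mul_cancel, map_one]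
    have h3 : linPart ⁅α, β⁆ * linPart ⁅β, α⁆ = 1 := by
      rw [← map_mul, ← commutatorElement_inv α β, mul_inv_cancel, map_one]
    have h4 : Commute (linPart ⁅β, α⁆) (linPart α) := by
      change _ = _
      calc linPart ⁅β, α⁆ * linPart α
          = linPart ⁅β, α⁆ * (linPart α * linPart ⁅α, β⁆) * linPart ⁅β, α⁆ := by
            rw [mul_assoc, mul_assoc, h3, mul_one]
        _ = linPart α * linPart ⁅β, α⁆ := by rw [h1.eq, ← mul_assoc, h2, one_mul]
    rw [linPart_commutator_eq_one_of_commute h4 (by linarith), one_mul] at h2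
    exact h2

theorem linPart_commutator_eq_one (h : DiscreteTopology Γ) {α β : IsomE n} (hα : α ∈ Γ)
    (hβ : β ∈ Γ) (hsα : ‖linPart α - 1‖ ≤ 1 / 8) (hsβ : ‖linPart β - 1‖ ≤ 1 / 8) :
    linPart ⁅α, β⁆ = 1 := by
  obtain ⟨k, hk⟩ := iterate_commutator_eq_one h hα hβ hsα
  exact linPart_commutator_eq_one_of_iterate hsα k hsβ hk

/-- For orthogonal `A`, the range of `A - 1` is orthogonal to the fixed vectors of `A`. So the
kernel of `(A - 1)²` is that of `A - 1`. -/
theorem linPart_apply_eq_of_fix_sub {α : IsomE n} {w : ESpace n}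
    (h : linPart α (linPart α w - w) = linPart α w - w) : linPart α w = w := by
  have h1 : inner ℝ (linPart α w - w) (linPart α w - w) = (0 : ℝ) := by
    conv_lhs => rw [inner_sub_left]
    nth_rw 1 [← h]
    rw [inner_linPart, sub_self]
  exact sub_eq_zero.1 (inner_self_eq_zero.1 h1)

theorem commutator_translation_apply_zero {α τ : IsomE n} (hτ : linPart τ = 1) :
    ⁅α, τ⁆ 0 = linPart α (τ 0) - τ 0 := by
  have h1 : ∀ x, τ x = x + τ 0 := fun x => by rw [apply_eq τ x, hτ]; rfl
  have h2 : τ⁻¹ 0 = -τ 0 := τ.injective (by rw [apply_inv_apply, h1, neg_add_cancel])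
  have h3 : ⁅α, τ⁆ 0 = α (τ (α⁻¹ (τ⁻¹ 0))) := rfl
  rw [h3, h1, apply_add, apply_inv_apply, h2]
  abel

theorem linPart_commutator_translation {α τ : IsomE n} (hτ : linPart τ = 1) :
    linPart ⁅α, τ⁆ = 1 := by
  rw [linPart_commutator_eq_one_iff, hτ]
  exact Commute.one_right _

/-- On translations the commutator with `α` acts as `A - 1`; a vector killed by a power of `A - 1`
is already killed by `A - 1`. -/
theorem linPart_fix_of_iterate {α : IsomE n} : ∀ (k : ℕ) {τ : IsomE n}, linPart τ = 1 →
    (fun γ => ⁅α, γ⁆)^[k] τ = 1 → linPart α (τ 0) = τ 0 := by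
  intro k
  induction k with
  | zero =>
    rintro τ - rfl
    exact map_zero _
  | succ k ih =>
    intro τ hτ h
    rw [Function.iterate_succ_apply] at h
    have h1 := ih (linPart_commutator_translation hτ) h
    rw [commutator_translation_apply_zero hτ] at h1
    exact linPart_apply_eq_of_fix_sub h1

/-- Elements of a discrete group with small rotation parts commute. -/
theorem commutator_eq_one_of_small (h : DiscreteTopology Γ) {α β : IsomE n} (hα : α ∈ Γ)
    (hβ : β ∈ Γ) (hsα : ‖linPart α - 1‖ ≤ 1 / 8) (hsβ : ‖linPart β - 1‖ ≤ 1 / 8) :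
    ⁅α, β⁆ = 1 := by
  have hlin := linPart_commutator_eq_one h hα hβ hsα hsβ
  refine eq_one_of_linPart hlin ?_
  have hmem := commutator_mem hα hβ
  obtain ⟨k, hk⟩ := iterate_commutator_eq_one h hα hmem hsα
  have hA := linPart_fix_of_iterate k hlin hk
  obtain ⟨l, hl⟩ := iterate_commutator_eq_one h hβ hmem hsβ
  have hB := linPart_fix_of_iterate l hlin hl
  set w := ⁅α, β⁆ 0 with hw
  have h1 : ∀ x, ⁅α, β⁆ x = x + w := fun x => by rw [apply_eq _ x, hlin]; rfl
  have h2 : α (β 0) = β (α 0) + w := by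
    rw [← h1]
    have : α * β = ⁅α, β⁆ * (β * α) := by rw [commutatorElement_def]; group
    exact congrArg (fun g : IsomE n => g 0) this
  -- Both summands are orthogonal to `w`, because `A` and `B` fix `w`. Hence `w` is orthogonal to
  -- itself.
  have h3 : w = (linPart α (β 0) - β 0) - (linPart β (α 0) - α 0) := by
    rw [apply_eq α (β 0), apply_eq β (α 0)] at h2
    have h5 := eq_sub_of_add_eq' h2.symm
    rw [h5]; abel
  have h4 : inner ℝ w w = (0 : ℝ) := by
    have h5 : inner ℝ (linPart α (β 0)) w = inner ℝ (β 0) w := by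
      conv_lhs => rw [← hA]
      exact inner_linPart _ _ _
    have h6 : inner ℝ (linPart β (α 0)) w = inner ℝ (α 0) w := by
      conv_lhs => rw [← hB]
      exact inner_linPart _ _ _
    have h7 : inner ℝ w w
        = inner ℝ ((linPart α (β 0) - β 0) - (linPart β (α 0) - α 0)) w := by rw [← h3]
    rw [h7, inner_sub_left, inner_sub_left, inner_sub_left, h5, h6, sub_self, sub_self, sub_self]
  exact inner_self_eq_zero.1 h4

/-! ### Cocompact groups -/

theorem exists_dist_le (hc : CompactSpace (OrbitSpace Γ)) :
    ∃ R > 0, ∀ x y : ESpace n, ∃ γ ∈ Γ, dist x (γ y) ≤ R := by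
  obtain ⟨C, hC⟩ := Metric.isBounded_iff.1 (isCompact_univ (X := OrbitSpace Γ)).isBounded
  have hC0 : 0 ≤ C := dist_nonneg.trans (hC (Set.mem_univ (OrbitSpace.mk Γ 0))
    (Set.mem_univ (OrbitSpace.mk Γ 0)))
  refine ⟨C + 1, by linarith, fun x y => ?_⟩
  obtain ⟨γ, hγ⟩ := OrbitSpace.dist_mk_lt_iff.1 ((hC (Set.mem_univ (OrbitSpace.mk Γ x))
    (Set.mem_univ (OrbitSpace.mk Γ y))).trans_lt (lt_add_one C))
  exact ⟨γ.1, γ.2, hγ.le⟩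

/-- An isometry commuting with a cocompact group is a translation. -/
theorem linPart_eq_one_of_commute (hc : CompactSpace (OrbitSpace Γ)) {g : IsomE n}
    (hg : ∀ γ ∈ Γ, g * γ = γ * g) : linPart g = 1 := by
  obtain ⟨R, hR, h⟩ := exists_dist_le hc
  refine linPart_eq_one_of_bounded (C := 2 * R + dist (g 0) 0) fun x => ?_
  obtain ⟨γ, hγ, hx⟩ := h x 0
  have h1 := dist_triangle4 (g x) (g (γ 0)) (γ 0) x
  have h2 : g (γ 0) = γ (g 0) := congrArg (fun g : IsomE n => g 0) (hg γ hγ)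
  rw [g.dist_eq, dist_comm (γ 0) x, h2, γ.dist_eq] at h1
  linarith

theorem linPart_fix_of_commute {g γ : IsomE n} (hg : linPart g = 1) (h : g * γ = γ * g) :
    linPart γ (g 0) = g 0 := by
  have h2 : g (γ 0) = γ (g 0) := congrArg (fun g : IsomE n => g 0) h
  rw [apply_eq g (γ 0), hg, apply_eq γ (g 0)] at h2
  rw [one_apply_eq_self, add_comm] at h2
  exact (add_right_cancel h2).symm

theorem totallyBounded_range_linPart {ι : Type*} (f : ι → IsomE n) :
    TotallyBounded (Set.range fun i => linPart (f i)) := by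
  refine (isCompact_closedBall 0 1).totallyBounded.subset ?_
  rintro _ ⟨i, rfl⟩
  rw [mem_closedBall_zero_iff]
  exact norm_linPart_le _

/-- Elements of a crystallographic group with small rotation parts are translations. -/
theorem linPart_eq_one_of_small (hΓ : IsSpaceGroup Γ) {α : IsomE n} (hα : α ∈ Γ)
    (hs : ‖linPart α - 1‖ ≤ 1 / 8) : linPart α = 1 := by
  obtain ⟨R, hR, hcov⟩ := exists_dist_le hΓ.compact
  -- Any `γ` is `(γ f⁻¹) f` with `f` in a finite set and `γ f⁻¹` of small rotation part, hence
  -- commuting with `α`. So `α` displaces `γ 0` exactly as far as `f 0`, and cocompactness bounds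
  -- its displacement everywhere.
  obtain ⟨F, hF, hFcov⟩ := exists_finite_approx (fun γ : Γ => linPart γ.1)
    (totallyBounded_range_linPart _) (show (0 : ℝ) < 1 / 8 by norm_num)
  obtain ⟨C, hC⟩ := (hF.image fun f : Γ => dist (α (f.1 0)) (f.1 0)).bddAbove
  refine linPart_eq_one_of_bounded (C := 2 * R + C) fun x => ?_
  obtain ⟨γ, hγ, hx⟩ := hcov x 0
  obtain ⟨f, hf, hfγ⟩ := hFcov ⟨γ, hγ⟩
  have hβ : γ * f.1⁻¹ ∈ Γ := Γ.mul_mem hγ (Γ.inv_mem f.2)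
  have hsβ : ‖linPart (γ * f.1⁻¹) - 1‖ ≤ 1 / 8 := by
    rw [← norm_mul_linPart f.1, sub_mul, one_mul, ← map_mul, inv_mul_cancel_right, ← dist_eq_norm]
    exact hfγ.le
  have hcomm := commutatorElement_eq_one_iff_mul_comm.1
    (commutator_eq_one_of_small hΓ.discrete hα hβ hs hsβ)
  have h2 : α (γ 0) = (γ * f.1⁻¹) (α (f.1 0)) := by
    have := congrArg (fun g : IsomE n => g (f.1 0)) hcomm
    simp only [mul_apply, inv_apply_apply] at this
    exact this
  have h3 : γ 0 = (γ * f.1⁻¹) (f.1 0) := by rw [mul_apply, inv_apply_apply]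
  have h1 := dist_triangle4 (α x) (α (γ 0)) (γ 0) x
  have h4 : dist (α (γ 0)) (γ 0) ≤ C := by
    rw [h2, h3, IsometryEquiv.dist_eq]
    exact hC (Set.mem_image_of_mem _ hf)
  rw [α.dist_eq, dist_comm (γ 0) x] at h1
  linarith

/-- The homomorphism from a group of isometries to its point group. -/
noncomputable abbrev linHom (Γ : Subgroup (IsomE n)) : Γ →* (ESpace n →L[ℝ] ESpace n) :=
  linPart.comp Γ.subtype

/-- The translation subgroup has finite index. -/
theorem finiteIndex_ker_linHom (hΓ : IsSpaceGroup Γ) : (linHom Γ).ker.FiniteIndex := by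
  have : Finite (Γ ⧸ (linHom Γ).ker) := by
    refine finite_of_separated (fun q : Γ ⧸ (linHom Γ).ker => linPart q.out.1)
      (totallyBounded_range_linPart _) (show (0 : ℝ) < 1 / 8 by norm_num) fun p q hpq => ?_
    rw [← p.out_eq', ← q.out_eq']
    refine QuotientGroup.eq.2 ?_
    rw [MonoidHom.mem_ker]
    refine linPart_eq_one_of_small hΓ (Γ.mul_mem (Γ.inv_mem p.out.2) q.out.2) ?_
    change ‖linPart (p.out.1⁻¹ * q.out.1) - 1‖ ≤ 1 / 8
    rw [← norm_linPart_mul p.out.1, mul_sub, ← map_mul, mul_one, mul_inv_cancel_left,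
      ← dist_eq_norm, dist_comm]
    exact hpq.le
  exact Subgroup.finiteIndex_of_finite_quotient

theorem commute_of_translation {α β : IsomE n} (hα : linPart α = 1) (hβ : linPart β = 1) :
    α * β = β * α := by
  refine ext_linPart (by rw [map_mul, map_mul, hα, hβ]) ?_
  rw [mul_apply, mul_apply, apply_eq α (β 0), apply_eq β (α 0), hα, hβ]
  exact add_comm _ _

/-- Crystallographic groups are finitely generated. -/
theorem group_fg (hΓ : IsSpaceGroup Γ) : Group.FG Γ := by
  obtain ⟨R, hR, hcov⟩ := exists_dist_le hΓ.compact
  set S : Set (IsomE n) := {γ | γ ∈ Γ ∧ ‖γ 0‖ ≤ 2 * R + 1} with hS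
  have hSf : S.Finite := finite_norm_apply_zero_le hΓ.discrete _
  have hclaim : ∀ k : ℕ, ∀ γ ∈ Γ, ‖γ 0‖ ≤ k → γ ∈ Subgroup.closure S := by
    intro k
    induction k with
    | zero =>
      intro γ hγ hk
      refine Subgroup.subset_closure ⟨hγ, hk.trans ?_⟩
      push_cast
      linarith
    | succ k ih =>
      intro γ hγ hk
      by_cases hle : ‖γ 0‖ ≤ 2 * R + 1
      · exact Subgroup.subset_closure ⟨hγ, hle⟩
      push Not at hle
      set L := ‖γ 0‖ with hL
      have hL0 : 0 < L := by linarith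
      -- Go `R + 1` from `γ 0` towards the origin. An orbit point within `R` of `y` has norm at most
      -- `L - 1`, and lies within `2 * R + 1` of `γ 0`.
      set y := (1 - (R + 1) / L) • γ 0 with hy
      have h1 : ‖y‖ = L - R - 1 := by
        rw [hy, norm_smul, ← hL, Real.norm_eq_abs, abs_of_nonneg]
        · field_simp
          ring
        · rw [sub_nonneg, div_le_one hL0]; linarith
      have h2 : dist (γ 0) y = R + 1 := by
        have : γ 0 - y = ((R + 1) / L) • γ 0 := by rw [hy, sub_smul, one_smul]; abel
        rw [dist_eq_norm, this, norm_smul, ← hL, Real.norm_eq_abs, abs_of_nonneg (by positivity)]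
        field_simp
      obtain ⟨δ, hδ, hd⟩ := hcov y 0
      have h3 : ‖δ 0‖ ≤ k := by
        have := dist_triangle (δ 0) y 0
        rw [dist_zero_right, dist_zero_right, dist_comm, h1] at this
        push_cast at hk
        linarith
      have h4 : δ⁻¹ * γ ∈ S := by
        refine ⟨Γ.mul_mem (Γ.inv_mem hδ) hγ, ?_⟩
        rw [← dist_zero_right, ← δ.dist_eq, ← mul_apply, mul_inv_cancel_left]
        linarith [dist_triangle (γ 0) y (δ 0)]
      have := Subgroup.mul_mem _ (ih δ hδ h3) (Subgroup.subset_closure h4)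
      rwa [mul_inv_cancel_left] at this
  rw [Group.fg_iff_subgroup_fg, Subgroup.fg_iff]
  refine ⟨S, le_antisymm ?_ fun γ hγ => ?_, hSf⟩
  · rw [Subgroup.closure_le]
    exact fun γ hγ => hγ.1
  · obtain ⟨k, hk⟩ := exists_nat_ge ‖γ 0‖
    exact hclaim k γ hγ hk

/-- If the abelianization is finite then the point group fixes no nonzero vector. -/
theorem eq_zero_of_finite_abelianization (hc : CompactSpace (OrbitSpace Γ))
    (hfin : Finite (Γ ⧸ commutator Γ)) {v : ESpace n} (hv : ∀ γ ∈ Γ, linPart γ v = v) :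
    v = 0 := by
  -- Additivity holds because every linear part fixes `v`.
  let f : Γ →* Multiplicative ℝ :=
    { toFun := fun γ => Multiplicative.ofAdd (inner ℝ (γ.1 0) v)
      map_one' := by
        change Multiplicative.ofAdd (inner ℝ (0 : ESpace n) v) = 1
        rw [inner_zero_left]; rfl
      map_mul' := fun γ δ => by
        rw [← ofAdd_add, Subgroup.coe_mul, mul_apply, apply_eq γ.1 (δ.1 0), inner_add_left]
        nth_rw 1 [← hv γ.1 γ.2]
        rw [inner_linPart, add_comm] }
  have hf : ∀ γ ∈ Γ, inner ℝ (γ 0) v = (0 : ℝ) := by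
    intro γ hγ
    have : Finite (Abelianization Γ) := hfin
    have h1 := pow_card_eq_one' (x := Abelianization.of (⟨γ, hγ⟩ : Γ))
    have h2 := congrArg (Abelianization.lift f) h1
    rw [map_pow, Abelianization.lift_apply_of, map_one] at h2
    have h3 : (Nat.card (Abelianization Γ) : ℝ) * inner ℝ (γ 0) v = 0 := by
      have := congrArg Multiplicative.toAdd h2
      rw [toAdd_pow, nsmul_eq_mul, toAdd_one] at this
      exact this
    exact (mul_eq_zero.1 h3).resolve_left (Nat.cast_ne_zero.2 Nat.card_pos.ne')
  by_contra hne
  have hpos : 0 < ‖v‖ := norm_pos_iff.2 hne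
  obtain ⟨R, hR, hcov⟩ := exists_dist_le hc
  -- The orbit of `0` lies in the hyperplane orthogonal to `v`, while this point is at distance `R +
  -- 1` from it.
  obtain ⟨γ, hγ, hd⟩ := hcov (((R + 1) / ‖v‖) • v) 0
  have h1 : inner ℝ (((R + 1) / ‖v‖) • v - γ 0) v = (R + 1) * ‖v‖ := by
    rw [inner_sub_left, hf γ hγ, sub_zero, inner_smul_left, real_inner_self_eq_norm_sq]
    simp only [conj_trivial]
    field_simp
  have h2 := real_inner_le_norm (((R + 1) / ‖v‖) • v - γ 0) v
  rw [h1, ← dist_eq_norm] at h2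
  nlinarith [le_of_mul_le_mul_right h2 hpos]

end IsomE

/-! ### Groups with a normal abelian subgroup of finite index -/

/-- Let `N` be an abelian normal subgroup of finite index in a finitely generated group `G`. If the
center of `G` is trivial then the abelianization of `G` is finite. -/
theorem finite_abelianization_of_center_eq_bot {G : Type*} [Group G] (hG : Group.FG G)
    (N : Subgroup G) [N.Normal] [N.FiniteIndex] (hN : ∀ a ∈ N, ∀ b ∈ N, a * b = b * a)
    (hZ : Subgroup.center G = ⊥) : Finite (G ⧸ commutator G) := by
  let _ : CommGroup N := { (inferInstance : Group N) with
    mul_comm := fun a b => Subtype.ext (hN a a.2 b b.2) }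
  have : Fintype (G ⧸ N) := Fintype.ofFinite _
  have hconj : ∀ (g : G), ∀ m ∈ N, ∀ a ∈ N, (g * m) * a * (g * m)⁻¹ = g * a * g⁻¹ := by
    intro g m hm a ha
    rw [mul_inv_rev, mul_assoc g m a, hN m hm a ha]
    group
  have key : ∀ a ∈ N, Abelianization.of a ^ N.index = 1 := by
    intro a ha
    let c : G → N := fun g => ⟨g * a * g⁻¹, (inferInstance : N.Normal).conj_mem a ha g⟩
    -- As `N` is abelian, a conjugate of `a` depends only on the coset of the conjugator.
    -- Conjugation by `G` therefore permutes the factors and fixes `P`.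
    let P : N := ∏ q : G ⧸ N, c q.out
    have hc : ∀ (g : G) (q : G ⧸ N), MulAut.conjNormal g (c q.out) = c (g • q).out := by
      intro g q
      obtain ⟨m, hm⟩ := QuotientGroup.mk_out_eq_mul N (g * q.out)
      have h1 : ((g * q.out : G) : G ⧸ N) = g • q := by
        conv_rhs => rw [← q.out_eq']
        rfl
      rw [h1] at hm
      apply Subtype.ext
      rw [MulAut.conjNormal_apply]
      change g * (q.out * a * q.out⁻¹) * g⁻¹ = (g • q).out * a * (g • q).out⁻¹
      rw [hm, hconj _ _ m.2 a ha]
      group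
    have hP : (P : G) ∈ Subgroup.center G := by
      refine Subgroup.mem_center_iff.2 fun g => ?_
      have h1 : MulAut.conjNormal g P = P := by
        rw [map_prod]
        simp only [hc]
        exact Fintype.prod_equiv (MulAction.toPerm g) _ _ fun q => rfl
      have h2 := congrArg Subtype.val h1
      rw [MulAut.conjNormal_apply] at h2
      exact mul_inv_eq_iff_eq_mul.1 h2
    rw [hZ, Subgroup.mem_bot] at hP
    have h3 : (Abelianization.of.comp N.subtype) P = Abelianization.of a ^ N.index := by
      rw [map_prod]
      have : ∀ q : G ⧸ N, (Abelianization.of.comp N.subtype) (c q.out) = Abelianization.of a := by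
        intro q
        change Abelianization.of (q.out * a * q.out⁻¹) = _
        rw [map_mul, map_mul, map_inv, mul_inv_cancel_comm]
      rw [Finset.prod_congr rfl fun q _ => this q, Finset.prod_const, Finset.card_univ,
        Subgroup.index, Nat.card_eq_fintype_card]
    rw [← h3]
    change Abelianization.of (P : G) = 1
    rw [hP, map_one]
  have hpos : 0 < N.index := Nat.pos_of_ne_zero Subgroup.FiniteIndex.index_ne_zero
  have hfg : Group.FG (Abelianization G) := by
    have := hG
    exact QuotientGroup.fg (N := commutator G)
  have ht : IsMulTorsion (Abelianization G) := by
    intro x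
    obtain ⟨g, rfl⟩ := QuotientGroup.mk_surjective x
    -- One factor of the index brings `g` into `N`; the other kills elements of `N` in the
    -- abelianization.
    refine isOfFinOrder_iff_pow_eq_one.2 ⟨N.index * N.index, Nat.mul_pos hpos hpos, ?_⟩
    have := key _ (Subgroup.pow_index_mem N g)
    rw [map_pow, ← pow_mul] at this
    exact this
  exact CommGroup.finite_of_fg_isMulTorsion (G := Abelianization G) ht

/-! ### Generic points -/

/-- A nonempty open set contains a point outside the zero sets of countably many functions, each
of which is affine and not constant along the lines of some direction. -/
theorem exists_mem_forall_ne_zero {E V ι : Type*} [NormedAddCommGroup E] [NormedSpace ℝ E]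
    [CompleteSpace E] [NormedAddCommGroup V] [NormedSpace ℝ V] [Countable ι] (F : ι → E → V)
    (hc : ∀ i, Continuous (F i))
    (hF : ∀ i, ∃ w e, e ≠ 0 ∧ ∀ (z : E) (t : ℝ), F i (z + t • w) = F i z + t • e)
    {U : Set E} (hU : IsOpen U) (hne : U.Nonempty) : ∃ z ∈ U, ∀ i, F i z ≠ 0 := by
  -- Baire's theorem; each nonvanishing set is dense because moving off a zero along `w` leaves the
  -- zero set at once.
  have hd : Dense (⋂ i, {z | F i z ≠ 0}) := by
    refine dense_iInter_of_isOpen (fun i => isOpen_ne_fun (hc i) continuous_const) fun i z => ?_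
    obtain ⟨w, e, he, hz⟩ := hF i
    by_cases h0 : F i z ≠ 0
    · exact subset_closure h0
    have hl : Tendsto (fun t : ℝ => z + t • w) (𝓝[≠] 0) (𝓝 z) := by
      have : Tendsto (fun t : ℝ => z + t • w) (𝓝 0) (𝓝 (z + (0 : ℝ) • w)) :=
        Continuous.tendsto (by fun_prop) 0
      rw [zero_smul, add_zero] at this
      exact this.mono_left nhdsWithin_le_nhds
    refine mem_closure_of_tendsto hl (eventually_mem_nhdsWithin.mono fun t ht => ?_)
    change F i (z + t • w) ≠ 0
    rw [hz, not_not.1 h0, zero_add]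
    exact smul_ne_zero ht he
  obtain ⟨z, hzU, hz⟩ := hd.inter_open_nonempty U hU hne
  exact ⟨z, hzU, fun i => Set.mem_iInter.1 hz i⟩

/-! ### Equidistant points and Dirichlet-Voronoi cells -/

/-- The normal of a hyperplane that contains `a` and all points equidistant from `p`, `q`, `r`. -/
noncomputable def equidistNormal {E : Type*} [NormedAddCommGroup E] [InnerProductSpace ℝ E]
    (a p q r : E) : E :=
  (dist a r ^ 2 - dist a p ^ 2) • (q - p) - (dist a q ^ 2 - dist a p ^ 2) • (r - p)

/-- Differences of squared distances are affine in the point, and the normal comes from the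
combination of two of them that vanishes at `a`. It could be zero only for collinear `p`, `q`, `r`,
but three distinct collinear points have no equidistant point. -/
theorem equidistNormal_spec {E : Type*} [NormedAddCommGroup E] [InnerProductSpace ℝ E]
    {a c p q r : E} {s : ℝ}
    (hq : dist (a + s • c) p = dist (a + s • c) q) (hr : dist (a + s • c) p = dist (a + s • c) r)
    (hpq : p ≠ q) (hpr : p ≠ r) (hqr : q ≠ r) (haq : dist a p ≠ dist a q) :
    equidistNormal a p q r ≠ 0 ∧ inner ℝ (equidistNormal a p q r) c = 0 := by
  have hkey : ∀ y, dist (a + s • c) p = dist (a + s • c) y →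
      2 * inner ℝ ((a - p) + s • c) (y - p) = ‖y - p‖ ^ 2 ∧
      dist a y ^ 2 - dist a p ^ 2 = 2 * s * inner ℝ c (y - p) := by
    intro y hy
    have h1 : a + s • c - y = (a + s • c - p) - (y - p) := by abel
    have h2 : a - y = (a - p) - (y - p) := by abel
    have h3 : (a - p) + s • c = a + s • c - p := by abel
    have h4 : inner ℝ (a + s • c - p) (y - p) = inner ℝ (a - p) (y - p) + s * inner ℝ c (y - p) := by
      rw [← h3, inner_add_left, inner_smul_left]; simp
    rw [dist_eq_norm, dist_eq_norm] at hy
    have h5 := norm_sub_sq_real (a + s • c - p) (y - p)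
    rw [← h1, ← hy] at h5
    have h6 := norm_sub_sq_real (a - p) (y - p)
    rw [← h2] at h6
    rw [dist_eq_norm, dist_eq_norm, h3]
    constructor <;> linarith
  obtain ⟨hq1, hq2⟩ := hkey q hq
  obtain ⟨hr1, hr2⟩ := hkey r hr
  constructor
  · intro h0
    have hE1 : dist a q ^ 2 - dist a p ^ 2 ≠ 0 := by
      intro h
      rw [sub_eq_zero, sq_eq_sq₀ dist_nonneg dist_nonneg] at h
      exact haq h.symm
    rw [equidistNormal, sub_eq_zero] at h0
    set e := dist a q ^ 2 - dist a p ^ 2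
    set f := dist a r ^ 2 - dist a p ^ 2
    set u := q - p with hu
    set v := r - p with hv
    have hu0 : u ≠ 0 := sub_ne_zero.2 hpq.symm
    have hv0 : v = (f / e) • u := by
      rw [div_eq_inv_mul, mul_smul, h0, smul_smul, inv_mul_cancel₀ hE1, one_smul]
    set k := f / e
    rw [hv0, inner_smul_right, norm_smul, mul_pow, Real.norm_eq_abs, sq_abs] at hr1
    have hn : ‖u‖ ^ 2 ≠ 0 := by positivity
    have h3 : k * (k - 1) * ‖u‖ ^ 2 = 0 := by linear_combination (-1 : ℝ) * hr1 + k * hq1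
    rcases mul_eq_zero.1 ((mul_eq_zero.1 h3).resolve_right hn) with h4 | h4
    · rw [h4, zero_smul] at hv0
      exact hpr (sub_eq_zero.1 hv0).symm
    · rw [sub_eq_zero.1 h4, one_smul] at hv0
      exact hqr (sub_left_injective hv0.symm)
  · rw [equidistNormal, inner_sub_left, inner_smul_left, inner_smul_left, hq2, hr2,
      real_inner_comm c (q - p), real_inner_comm c (r - p)]
    simp only [conj_trivial]
    ring

namespace IsomE

variable {n : ℕ} {Γ : Subgroup (IsomE n)}

/-- The orbit of `x` under a set of isometries. -/
def orbitSet (T : Set (IsomE n)) (x : ESpace n) : Set (ESpace n) := (fun γ : IsomE n => γ x) '' T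

/-- Every ball contains `γ x` for only finitely many `γ ∈ T`. -/
def FiniteAt (T : Set (IsomE n)) (x : ESpace n) : Prop :=
  ∀ (z : ESpace n) (C : ℝ), {γ | γ ∈ T ∧ dist z (γ x) ≤ C}.Finite

theorem FiniteAt.mono {T T' : Set (IsomE n)} {x : ESpace n} (h : FiniteAt T x) (hT : T' ⊆ T) :
    FiniteAt T' x :=
  fun z C => (h z C).subset fun _ hγ => ⟨hT hγ.1, hγ.2⟩

theorem FiniteAt.countable {T : Set (IsomE n)} {x : ESpace n} (h : FiniteAt T x) :
    T.Countable := by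
  refine (Set.countable_iUnion fun k : ℕ => (h x k).countable).mono fun γ hγ => ?_
  obtain ⟨k, hk⟩ := exists_nat_ge (dist x (γ x))
  exact Set.mem_iUnion.2 ⟨k, hγ, hk⟩

theorem FiniteAt.exists_infDist_eq {T : Set (IsomE n)} {x : ESpace n} (h : FiniteAt T x)
    (hne : T.Nonempty) (z : ESpace n) :
    ∃ γ ∈ T, Metric.infDist z (orbitSet T x) = dist z (γ x) := by
  obtain ⟨δ, hδ⟩ := hne
  obtain ⟨γ, hγ, hmin⟩ := Set.exists_min_image _ (fun γ : IsomE n => dist z (γ x))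
    (h z (dist z (δ x))) ⟨δ, hδ, le_rfl⟩
  refine ⟨γ, hγ.1, le_antisymm (Metric.infDist_le_dist_of_mem (Set.mem_image_of_mem _ hγ.1)) ?_⟩
  refine (Metric.le_infDist (Set.Nonempty.image _ ⟨δ, hδ⟩)).2 ?_
  rintro _ ⟨β, hβ, rfl⟩
  by_cases hle : dist z (β x) ≤ dist z (δ x)
  · exact hmin β ⟨hβ, hle⟩
  · exact hγ.2.trans (not_le.1 hle).le

/-- A group with generic base point `x` is determined by the Dirichlet-Voronoi cell of `x`. -/
theorem le_of_voronoi_eq {Γ Γ' : Subgroup (IsomE n)} {x : ESpace n}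
    (hf : FiniteAt (Γ : Set (IsomE n)) x) (hf' : FiniteAt (Γ' : Set (IsomE n)) x)
    (hinj : ∀ β ∈ (Γ : Set (IsomE n)) ∪ Γ', ∀ β' ∈ (Γ : Set (IsomE n)) ∪ Γ',
      β x = β' x → β = β')
    (hV : ∀ z, (∀ γ ∈ Γ, dist z x ≤ dist z (γ x)) ↔ ∀ γ ∈ Γ', dist z x ≤ dist z (γ x)) :
    Γ ≤ Γ' := by
  intro γ₀ hγ₀
  by_contra hγ₀'
  set T : Set (IsomE n) := (Γ : Set (IsomE n)) ∪ Γ' with hT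
  have : Countable T := (hf.countable.union hf'.countable).to_subtype
  set T₁ : Set (IsomE n) := {γ | γ ∈ Γ ∧ γ ∈ Γ'} with hT₁
  set T₂ : Set (IsomE n) := {γ | γ ∈ Γ ∧ γ ∉ Γ'} with hT₂
  set T₃ : Set (IsomE n) := {γ | γ ∈ Γ' ∧ γ ≠ 1} with hT₃
  have hf₁ : FiniteAt T₁ x := hf.mono fun γ hγ => hγ.1
  have hf₂ : FiniteAt T₂ x := hf.mono fun γ hγ => hγ.1
  have hf₃ : FiniteAt T₃ x := hf'.mono fun γ hγ => hγ.1
  have hne₁ : T₁.Nonempty := ⟨1, Γ.one_mem, Γ'.one_mem⟩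
  have hne₂ : T₂.Nonempty := ⟨γ₀, hγ₀, hγ₀'⟩
  -- The sign of `f` tells whether the nearest point of `Γ x` comes from `Γ ∩ Γ'` or from outside
  -- `Γ'`. The aim is a zero of `f` on a path avoiding all points equidistant from three distinct
  -- points of the two orbits.
  set f : ESpace n → ℝ :=
    fun z => Metric.infDist z (orbitSet T₁ x) - Metric.infDist z (orbitSet T₂ x) with hfdef
  have hfc : Continuous f := (Metric.continuous_infDist_pt _).sub (Metric.continuous_infDist_pt _)
  have hfx : f x < 0 := by
    have h1 : Metric.infDist x (orbitSet T₁ x) = 0 := 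
      Metric.infDist_zero_of_mem
        (show x ∈ orbitSet T₁ x from ⟨1, ⟨Γ.one_mem, Γ'.one_mem⟩, rfl⟩)
    obtain ⟨γ, hγ, h2⟩ := hf₂.exists_infDist_eq hne₂ x
    have h3 : 0 < dist x (γ x) := by
      refine dist_pos.2 fun h => hγ.2 ?_
      rw [hinj γ (Or.inl hγ.1) 1 (Or.inl Γ.one_mem) h.symm]
      exact Γ'.one_mem
    rw [hfdef]
    simp only [h1, h2]
    linarith
  have hfγ : 0 < f (γ₀ x) := by
    have h1 : Metric.infDist (γ₀ x) (orbitSet T₂ x) = 0 :=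
      Metric.infDist_zero_of_mem ⟨γ₀, ⟨hγ₀, hγ₀'⟩, rfl⟩
    obtain ⟨γ, hγ, h2⟩ := hf₁.exists_infDist_eq hne₁ (γ₀ x)
    have h3 : 0 < dist (γ₀ x) (γ x) := by
      refine dist_pos.2 fun h => hγ₀' ?_
      rw [hinj γ₀ (Or.inl hγ₀) γ (Or.inl hγ.1) h]
      exact hγ.2
    rw [hfdef]
    simp only [h1, h2]
    linarith
  have ⟨a, ha, hagen⟩ : ∃ a, f a < 0 ∧ ∀ p ∈ T, ∀ q ∈ T, p ≠ q → dist a (p x) ≠ dist a (q x) := by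
    let ι := {i : T × T // i.1.1 ≠ i.2.1}
    let F : ι → ESpace n → ℝ := fun i z => dist z (i.1.1.1 x) ^ 2 - dist z (i.1.2.1 x) ^ 2
    obtain ⟨a, ha, h⟩ := exists_mem_forall_ne_zero F (fun i => by fun_prop) (by
      rintro ⟨⟨⟨p, hp⟩, ⟨q, hq⟩⟩, hpq⟩
      have hne : p x ≠ q x := fun h => hpq (hinj p hp q hq h)
      refine ⟨q x - p x, 2 * ‖q x - p x‖ ^ 2, ?_, fun z t => ?_⟩
      · have := sub_ne_zero.2 hne.symm
        positivity
      · simp only [F, dist_eq_norm]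
        have h1 : z + t • (q x - p x) - p x = (z - p x) + t • (q x - p x) := by abel
        have h2 : z + t • (q x - p x) - q x = (z - p x) + (t - 1) • (q x - p x) := by
          rw [sub_smul, one_smul]; abel
        have h3 : z - q x = (z - p x) - (q x - p x) := by abel
        rw [h1, h2, h3, norm_add_sq_real, norm_add_sq_real, norm_sub_sq_real (z - p x), inner_smul_right,
          inner_smul_right, norm_smul, norm_smul, mul_pow, mul_pow, Real.norm_eq_abs,
          Real.norm_eq_abs, sq_abs, sq_abs, smul_eq_mul]
        ring)
      (isOpen_lt hfc continuous_const) ⟨x, hfx⟩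
    refine ⟨a, ha, fun p hp q hq hpq heq => h ⟨⟨⟨p, hp⟩, ⟨q, hq⟩⟩, hpq⟩ ?_⟩
    simp only [F, heq, sub_self]
  have ⟨c, hc, hcgen⟩ : ∃ c, 0 < f c ∧ ∀ p ∈ T, ∀ q ∈ T, ∀ r ∈ T,
      equidistNormal a (p x) (q x) (r x) ≠ 0 →
        inner ℝ (equidistNormal a (p x) (q x) (r x)) (c - a) ≠ 0 := by
    let ι := {i : T × T × T // equidistNormal a (i.1.1 x) (i.2.1.1 x) (i.2.2.1 x) ≠ 0}
    let N : ι → ESpace n := fun i => equidistNormal a (i.1.1.1 x) (i.1.2.1.1 x) (i.1.2.2.1 x)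
    let F : ι → ESpace n → ℝ := fun i z => inner ℝ (N i) (z - a)
    obtain ⟨c, hc, h⟩ := exists_mem_forall_ne_zero F (fun i => by fun_prop) (by
      intro i
      refine ⟨N i, ‖N i‖ ^ 2, ?_, fun z t => ?_⟩
      · have : N i ≠ 0 := i.2
        positivity
      · simp only [F]
        rw [add_sub_right_comm, inner_add_right, inner_smul_right, real_inner_self_eq_norm_sq,
          smul_eq_mul])
      (isOpen_lt continuous_const hfc) ⟨γ₀ x, hfγ⟩
    exact ⟨c, hc, fun p hp q hq r hr hpqr => h ⟨⟨⟨p, hp⟩, ⟨q, hq⟩, ⟨r, hr⟩⟩, hpqr⟩⟩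
  obtain ⟨s, hfs⟩ : ∃ s : ℝ, f (a + s • (c - a)) = 0 := by
    have hcont : ContinuousOn (fun s : ℝ => f (a + s • (c - a))) (Set.Icc 0 1) :=
      Continuous.continuousOn (by fun_prop)
    have h01 : (0 : ℝ) ∈ Set.Icc (f (a + (0 : ℝ) • (c - a))) (f (a + (1 : ℝ) • (c - a))) := by
      rw [zero_smul, add_zero, one_smul, add_sub_cancel]
      exact ⟨ha.le, hc.le⟩
    obtain ⟨s, -, hs⟩ := intermediate_value_Icc zero_le_one hcont h01
    exact ⟨s, hs⟩
  set z := a + s • (c - a) with hz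
  obtain ⟨α, hα, hαz⟩ := hf₁.exists_infDist_eq hne₁ z
  obtain ⟨β, hβ, hβz⟩ := hf₂.exists_infDist_eq hne₂ z
  have hαβ : dist z (α x) = dist z (β x) := by
    rw [← hαz, ← hβz]; exact sub_eq_zero.1 hfs
  have hmin : ∀ γ ∈ Γ, dist z (α x) ≤ dist z (γ x) := by
    intro γ hγ
    by_cases h : γ ∈ Γ'
    · rw [← hαz]; exact Metric.infDist_le_dist_of_mem ⟨γ, ⟨hγ, h⟩, rfl⟩
    · rw [hαβ, ← hβz]; exact Metric.infDist_le_dist_of_mem ⟨γ, ⟨hγ, h⟩, rfl⟩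
  -- Since `α` lies in both groups, moving by `α⁻¹` puts the point in the common cell of `x`, on the
  -- wall towards `y`.
  set z₀ := α⁻¹ z with hz₀
  have hz₀d : ∀ γ : IsomE n, dist z₀ (γ x) = dist z ((α * γ) x) := by
    intro γ
    rw [mul_apply, dist_apply_right α]
  have hz₀x : dist z₀ x = dist z (α x) := hz₀d 1
  have hvor : ∀ γ ∈ Γ, dist z₀ x ≤ dist z₀ (γ x) := by
    intro γ hγ
    rw [hz₀x, hz₀d]
    exact hmin _ (Γ.mul_mem hα.1 hγ)
  have hvor' := (hV z₀).1 hvor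
  set y := (α⁻¹ * β) x with hy
  have hz₀y : dist z₀ y = dist z₀ x := by
    rw [hy, hz₀d, mul_inv_cancel_left, hz₀x, hαβ]
  have hyx : y ≠ x := by
    intro h
    have h1 := hinj _ (Or.inl (Γ.mul_mem (Γ.inv_mem hα.1) hβ.1)) 1 (Or.inl Γ.one_mem) h
    rw [inv_mul_eq_one] at h1
    exact hβ.2 (h1 ▸ hα.2)
  -- Moving from `z₀` towards `y` leaves the cell of `Γ`, hence that of `Γ'`, so some nontrivial
  -- element of `Γ'` brings `x` closer. Letting `t → 0` gives a wall of `Γ'` through `z₀`.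
  have hne₃ : ∀ t : ℝ, 0 < t → T₃.Nonempty ∧
      Metric.infDist (z₀ + t • (y - x)) (orbitSet T₃ x) ≤ dist (z₀ + t • (y - x)) x := by
    intro t ht
    have h1 : ¬ ∀ γ ∈ Γ, dist (z₀ + t • (y - x)) x ≤ dist (z₀ + t • (y - x)) (γ x) := by
      intro h
      have h2 := h _ (Γ.mul_mem (Γ.inv_mem hα.1) hβ.1)
      rw [← hy, ← sq_le_sq₀ dist_nonneg dist_nonneg] at h2
      have h3 : dist z₀ y ^ 2 = dist z₀ x ^ 2 := by rw [hz₀y]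
      rw [dist_eq_norm, dist_eq_norm] at h2 h3
      have h4 : z₀ + t • (y - x) - x = (z₀ - x) + t • (y - x) := by abel
      have h5 : z₀ + t • (y - x) - y = (z₀ - y) + t • (y - x) := by abel
      have h6 : (z₀ - x) = (z₀ - y) + (y - x) := by abel
      rw [h4, h5, norm_add_sq_real, norm_add_sq_real, h3, inner_smul_right, inner_smul_right, h6,
        inner_add_left, real_inner_self_eq_norm_sq] at h2
      have h7 : 0 < ‖y - x‖ := norm_pos_iff.2 (sub_ne_zero.2 hyx)
      have : 0 < t * ‖y - x‖ ^ 2 := by positivity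
      linarith
    rw [hV] at h1
    push Not at h1
    obtain ⟨γ, hγ, h2⟩ := h1
    have h3 : γ ∈ T₃ := ⟨hγ, fun h => by rw [h] at h2; exact lt_irrefl _ h2⟩
    exact ⟨⟨γ, h3⟩, (Metric.infDist_le_dist_of_mem (Set.mem_image_of_mem _ h3)).trans h2.le⟩
  have hinf₃ : Metric.infDist z₀ (orbitSet T₃ x) ≤ dist z₀ x := by
    have hc1 : ContinuousWithinAt (fun t : ℝ => Metric.infDist (z₀ + t • (y - x)) (orbitSet T₃ x))
        (Set.Ioi 0) 0 := Continuous.continuousWithinAt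
          ((Metric.continuous_infDist_pt _).comp (by fun_prop))
    have hc2 : ContinuousWithinAt (fun t : ℝ => dist (z₀ + t • (y - x)) x) (Set.Ioi 0) 0 :=
      Continuous.continuousWithinAt (by fun_prop)
    have := ContinuousWithinAt.closure_le (by simp) hc1 hc2 fun t ht => (hne₃ t ht).2
    simpa only [zero_smul, add_zero] using this
  obtain ⟨β', hβ', hβ'z⟩ := hf₃.exists_infDist_eq (hne₃ 1 one_pos).1 z₀
  have hβ'd : dist z (α x) = dist z ((α * β') x) := by
    rw [← hz₀d, ← hz₀x]
    exact le_antisymm (hvor' β' hβ'.1) (hβ'z ▸ hinf₃)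
  have hmα : α ∈ T := Or.inl hα.1
  have hmβ : β ∈ T := Or.inl hβ.1
  have hmβ' : α * β' ∈ T := Or.inr (Γ'.mul_mem hα.2 hβ'.1)
  have hneαβ : α ≠ β := fun h => hβ.2 (h ▸ hα.2)
  have hneββ' : β ≠ α * β' := fun h => hβ.2 (h ▸ Γ'.mul_mem hα.2 hβ'.1)
  have hneαβ' : α ≠ α * β' := fun h => hβ'.2 (left_eq_mul.1 h)
  -- Now `z` is equidistant from `α x`, `β x` and `(α * β') x`, which are distinct because `β ∉ Γ'`.
  -- The choice of `c` excludes this.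
  have hspec := equidistNormal_spec hαβ hβ'd (fun h => hneαβ (hinj _ hmα _ hmβ h))
    (fun h => hneαβ' (hinj _ hmα _ hmβ' h))
    (fun h => hneββ' (hinj _ hmβ _ hmβ' h)) (hagen _ hmα _ hmβ hneαβ)
  exact hcgen _ hmα _ hmβ _ hmβ' hspec.1 hspec.2

end IsomE

/-! ### Local isometries and their extension over a Dirichlet cell -/

/-- A distance preserving map of a ball of `E^n` into `E^n` extends to an isometry of `E^n`. -/
theorem exists_isometry_eq_on_closedBall {n : ℕ} {f : ESpace n → ESpace n} {x : ESpace n} {r : ℝ}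
    (hr : 0 < r) (h : ∀ p ∈ Metric.closedBall x r, ∀ q ∈ Metric.closedBall x r,
      dist (f p) (f q) = dist p q) :
    ∃ g : IsomE n, ∀ p ∈ Metric.closedBall x r, g p = f p := by
  set u : ESpace n → ESpace n := fun v => f (x + v) - f x with hu
  have hmem : ∀ v : ESpace n, ‖v‖ ≤ r → x + v ∈ Metric.closedBall x r := fun v hv => by
    rwa [Metric.mem_closedBall, dist_self_add_left]
  have hx : x ∈ Metric.closedBall x r := Metric.mem_closedBall_self hr.le
  have hnorm : ∀ v, ‖v‖ ≤ r → ‖u v‖ = ‖v‖ := fun v hv => by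
    rw [hu, ← dist_eq_norm, h _ (hmem v hv) _ hx, dist_self_add_left]
  have hin : ∀ v w, ‖v‖ ≤ r → ‖w‖ ≤ r → inner ℝ (u v) (u w) = inner ℝ v w := by
    intro v w hv hw
    have h1 : ‖u v - u w‖ = ‖v - w‖ := by
      have : u v - u w = f (x + v) - f (x + w) := sub_sub_sub_cancel_right _ _ _
      rw [this, ← dist_eq_norm, h _ (hmem v hv) _ (hmem w hw), dist_add_left, dist_eq_norm]
    have h2 := norm_sub_sq_real (u v) (u w)
    have h3 := norm_sub_sq_real v w
    rw [h1, hnorm v hv, hnorm w hw] at h2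
    linarith
  let b := EuclideanSpace.basisFun (Fin n) ℝ
  have hb : ∀ i, ‖r • b i‖ ≤ r := fun i => by
    rw [norm_smul, b.norm_eq_one, mul_one, Real.norm_eq_abs, abs_of_pos hr]
  have hon : Orthonormal ℝ fun i => r⁻¹ • u (r • b i) := by
    rw [orthonormal_iff_ite]
    intro i j
    rw [inner_smul_left, inner_smul_right, hin _ _ (hb i) (hb j), inner_smul_left,
      inner_smul_right, orthonormal_iff_ite.1 b.orthonormal i j]
    simp only [conj_trivial]
    field_simp
  let b' : OrthonormalBasis (Fin n) ℝ (ESpace n) := OrthonormalBasis.mk hon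
    (hon.linearIndependent.span_eq_top_of_card_eq_finrank' (by simp)).ge
  have hb' : ∀ i, b' i = r⁻¹ • u (r • b i) := fun i => by rw [OrthonormalBasis.coe_mk]
  -- Inner products with the vectors `u (r • b i)` determine a vector, and `hin` prescribes them, so
  -- `L` agrees with `u` on the whole ball.
  let L := b.equiv b' (Equiv.refl _)
  have hL : ∀ v, ‖v‖ ≤ r → L v = u v := by
    intro v hv
    refine InnerProductSpace.ext_inner_left_basis b'.toBasis fun i => ?_
    rw [OrthonormalBasis.coe_toBasis]
    have h1 : L (b i) = b' i := by simp [L]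
    nth_rw 1 [← h1]
    rw [L.inner_map_map, hb', inner_smul_left, hin _ _ (hb i) hv, inner_smul_left]
    simp only [conj_trivial]
    field_simp
  refine ⟨L.toIsometryEquiv.trans (IsometryEquiv.addRight (f x - L x)), fun p hp => ?_⟩
  have h1 : L (p - x) = f p - f x := by
    rw [hL _ (by rwa [← dist_eq_norm])]
    simp only [hu, add_sub_cancel]
  change L p + (f x - L x) = f p
  rw [map_sub] at h1
  rw [← sub_eq_zero] at h1 ⊢
  rw [← h1]; abel

namespace OrbitSpace

variable {n : ℕ} {Γ : Subgroup (IsomE n)}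

theorem mk_apply {γ : IsomE n} (hγ : γ ∈ Γ) (x : ESpace n) : mk Γ (γ x) = mk Γ x :=
  mk_smul ⟨γ, hγ⟩ x

theorem dist_mk_mk_le {γ : IsomE n} (hγ : γ ∈ Γ) (x y : ESpace n) :
    dist (mk Γ x) (mk Γ y) ≤ dist x (γ y) :=
  Metric.infDist_le_dist_of_mem ⟨⟨γ, hγ⟩, rfl⟩

theorem exists_dist_mk_eq (h : DiscreteTopology Γ) (x y : ESpace n) :
    ∃ γ ∈ Γ, dist (mk Γ x) (mk Γ y) = dist x (γ y) := by
  have hf : IsomE.FiniteAt (Γ : Set (IsomE n)) y := fun z C =>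
    IsomE.finite_dist_apply_le h z y C
  obtain ⟨γ, hγ, hd⟩ := hf.exists_infDist_eq ⟨1, Γ.one_mem⟩ x
  refine ⟨γ, hγ, ?_⟩
  rw [← hd]
  have : MulAction.orbit Γ y = IsomE.orbitSet (Γ : Set (IsomE n)) y := by
    ext p
    constructor
    · rintro ⟨δ, rfl⟩
      exact ⟨δ.1, δ.2, rfl⟩
    · rintro ⟨δ, hδ, rfl⟩
      exact ⟨⟨δ, hδ⟩, rfl⟩
  change Metric.infDist x (MulAction.orbit Γ y) = _
  rw [this]

theorem dist_mk_eq_of_dirichlet (h : DiscreteTopology Γ) {x z : ESpace n}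
    (hz : ∀ γ ∈ Γ, dist z x ≤ dist z (γ x)) : dist (mk Γ z) (mk Γ x) = dist z x := by
  obtain ⟨γ, hγ, hd⟩ := exists_dist_mk_eq h z x
  exact le_antisymm (dist_mk_mk_le Γ.one_mem z x) (hd ▸ hz γ hγ)

theorem exists_mem_dirichlet (h : DiscreteTopology Γ) (x : ESpace n) (p : OrbitSpace Γ) :
    ∃ z, mk Γ z = p ∧ ∀ γ ∈ Γ, dist z x ≤ dist z (γ x) := by
  obtain ⟨y, rfl⟩ := mk_surjective p
  obtain ⟨γ, hγ, hd⟩ := exists_dist_mk_eq h x y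
  refine ⟨γ y, mk_apply hγ y, fun δ hδ => ?_⟩
  rw [dist_comm, ← hd, ← mk_apply hγ y, dist_comm]
  exact dist_mk_mk_le hδ _ _

/-- Let `p` be the point of the segment from `x` to `z` at distance `r` from `x`, and let `w`
represent `φ (mk Γ z)` nearest to `g p`. Because `z` is in the cell of `x`, the distances from `g⁻¹
w` to `p` and `x` force equality in the triangle inequality, so `g⁻¹ w` is on the same ray at the
same distance as `z`. -/
theorem apply_mk_of_dirichlet (hd : DiscreteTopology Γ) (φ : IsomOrbitSpace Γ) (g : IsomE n)
    {x : ESpace n} {r : ℝ} (hr : 0 < r)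
    (hloc : ∀ p ∈ Metric.closedBall x r, φ (mk Γ p) = mk Γ (g p)) {z : ESpace n}
    (hz : ∀ γ ∈ Γ, dist z x ≤ dist z (γ x)) : φ (mk Γ z) = mk Γ (g z) := by
  by_cases hle : dist z x ≤ r
  · exact hloc z hle
  push Not at hle
  set l := dist z x with hl
  have hl0 : 0 < l := hr.trans hle
  set p := x + (r / l) • (z - x) with hp
  have hxp : dist x p = r := by
    rw [hp, dist_self_add_right, norm_smul, ← dist_eq_norm, ← hl, Real.norm_eq_abs,
      abs_of_pos (by positivity), div_mul_cancel₀ _ hl0.ne']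
  have hpz : dist p z = l - r := by
    have : p - z = (r / l - 1) • (z - x) := by rw [hp, sub_smul, one_smul]; abel
    rw [dist_eq_norm, this, norm_smul, ← dist_eq_norm z x, ← hl, Real.norm_eq_abs, abs_of_nonpos]
    · field_simp
      ring
    · rw [sub_nonpos, div_le_one hl0]; exact hle.le
  have hpm : p ∈ Metric.closedBall x r := by rw [Metric.mem_closedBall, dist_comm, hxp]
  obtain ⟨w', hw'⟩ := mk_surjective (φ (mk Γ z))
  obtain ⟨γ, hγ, hγd⟩ := exists_dist_mk_eq hd (g p) w'
  rw [← mk_apply hγ w'] at hw'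
  set w := γ w' with hw
  rw [mk_apply hγ w' |>.symm] at hγd
  have h1 : dist p (g⁻¹ w) ≤ l - r := by
    rw [← g.dist_eq, IsomE.apply_inv_apply, ← hγd, hw', ← hloc p hpm]
    refine (φ.dist_eq _ _).trans_le (le_trans (dist_mk_mk_le Γ.one_mem p z) ?_)
    exact hpz.le
  have h2 : l ≤ dist x (g⁻¹ w) := by
    rw [← g.dist_eq, IsomE.apply_inv_apply]
    refine le_trans ?_ (dist_mk_mk_le Γ.one_mem (g x) w)
    rw [hw', ← hloc x (Metric.mem_closedBall_self hr.le)]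
    refine le_trans ?_ (φ.dist_eq _ _).ge
    rw [dist_comm]
    exact (dist_mk_eq_of_dirichlet hd hz).ge
  have h3 := dist_triangle x p (g⁻¹ w)
  have h4 : dist x p + dist p (g⁻¹ w) = dist x (g⁻¹ w) := by linarith
  have h5 : dist x (g⁻¹ w) = l := by linarith
  obtain ⟨t, ht, htp⟩ := dist_add_dist_eq_iff.1 h4
  rw [AffineMap.lineMap_apply, vsub_eq_sub, vadd_eq_add, add_comm] at htp
  have h6 : t = r / l := by
    rw [← htp, dist_self_add_right, norm_smul, ← dist_eq_norm, dist_comm, h5, Real.norm_eq_abs,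
      abs_of_nonneg ht.1] at hxp
    rw [← hxp, mul_div_cancel_right₀ _ hl0.ne']
  rw [hp, h6] at htp
  have h7 : g⁻¹ w = z := by
    have := smul_right_injective (ESpace n) (div_pos hr hl0).ne' (add_left_cancel htp)
    exact sub_left_injective this
  rw [← hw', ← h7, IsomE.apply_inv_apply]

/-- As `g` preserves distances, this says that `g` carries the Dirichlet cell of `x` into that of `g
x`. -/
theorem dist_le_of_local_lift (hd : DiscreteTopology Γ) (φ : IsomOrbitSpace Γ) (g : IsomE n)
    {x : ESpace n} {r : ℝ} (hr : 0 < r)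
    (hloc : ∀ p ∈ Metric.closedBall x r, φ (mk Γ p) = mk Γ (g p)) {z : ESpace n}
    (hz : ∀ γ ∈ Γ, dist z x ≤ dist z (γ x)) {δ : IsomE n} (hδ : δ ∈ Γ) :
    dist z x ≤ dist (g z) (δ (g x)) := by
  refine le_trans ?_ (dist_mk_mk_le hδ _ _)
  rw [← apply_mk_of_dirichlet hd φ g hr hloc hz, ← hloc x (Metric.mem_closedBall_self hr.le)]
  exact (dist_mk_eq_of_dirichlet hd hz).ge.trans (φ.dist_eq _ _).ge

end OrbitSpace

namespace IsomE

open OrbitSpace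

variable {n : ℕ} {Γ : Subgroup (IsomE n)}

theorem eq_of_linPart_eq {β β' : IsomE n} {x : ESpace n} (h : linPart β = linPart β')
    (hx : β x = β' x) : β = β' := by
  refine ext_linPart h ?_
  rw [apply_eq β, apply_eq β', h] at hx
  exact add_left_cancel hx

/-- Isometries with different linear parts agree only on a proper affine subspace, possibly empty;
those with equal linear parts agree nowhere unless equal. Countably many such subspaces can be
avoided. -/
theorem exists_generic {T : Set (IsomE n)} (hT : T.Countable) {U : Set (ESpace n)}
    (hU : IsOpen U) (hne : U.Nonempty) :
    ∃ x ∈ U, ∀ β ∈ T, ∀ β' ∈ T, β x = β' x → β = β' := by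
  have := hT.to_subtype
  let ι := {i : T × T // linPart i.1.1 ≠ linPart i.2.1}
  let F : ι → ESpace n → ESpace n := fun i z => i.1.1.1 z - i.1.2.1 z
  obtain ⟨x, hxU, hx⟩ := exists_mem_forall_ne_zero F
    (fun i => i.1.1.1.continuous.sub i.1.2.1.continuous) (by
      rintro ⟨⟨⟨p, hp⟩, ⟨q, hq⟩⟩, hpq⟩
      obtain ⟨w, hw⟩ := DFunLike.ne_iff.1 hpq
      refine ⟨w, linPart p w - linPart q w, sub_ne_zero.2 hw, fun z t => ?_⟩
      simp only [F]
      rw [apply_add, apply_add, map_smul, map_smul, smul_sub]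
      abel) hU hne
  refine ⟨x, hxU, fun β hβ β' hβ' h => ?_⟩
  by_contra hne'
  exact hx ⟨⟨⟨β, hβ⟩, ⟨β', hβ'⟩⟩, fun hl => hne' (eq_of_linPart_eq hl h)⟩ (sub_eq_zero.2 h)

/-- If an isometry of the orbit space is locally induced by an isometry `g` of `E^n` then `g`
conjugates `Γ` into itself. -/
theorem conj_mem_of_local_lift (hd : DiscreteTopology Γ) (φ : IsomOrbitSpace Γ) (g : IsomE n)
    {x₀ : ESpace n} {r₀ : ℝ} (hr₀ : 0 < r₀)
    (hloc₀ : ∀ p ∈ Metric.closedBall x₀ r₀, φ (mk Γ p) = mk Γ (g p)) :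
    ∀ γ ∈ Γ, g * γ * g⁻¹ ∈ Γ := by
  -- This is `g⁻¹ Γ g`. Its cell at `x` is the pullback by `g` of the cell of `Γ` at `g x`; the
  -- lifts of `φ` and `φ.symm` give the two inclusions between cells.
  let Γ' : Subgroup (IsomE n) := Γ.comap (MulAut.conj g).toMonoidHom
  have hΓ' : ∀ γ, γ ∈ Γ' ↔ g * γ * g⁻¹ ∈ Γ := fun γ => Iff.rfl
  have hf : ∀ x, FiniteAt (Γ : Set (IsomE n)) x := fun x z C => finite_dist_apply_le hd z x C
  have hf' : ∀ x, FiniteAt (Γ' : Set (IsomE n)) x := fun x z C => by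
    refine ((hf (g x) (g z) C).preimage (MulAut.conj g).injective.injOn).subset
      fun γ hγ => ⟨hγ.1, ?_⟩
    rw [MulAut.conj_apply, mul_apply, mul_apply, inv_apply_apply, g.dist_eq]
    exact hγ.2
  obtain ⟨x, hxU, hinj⟩ := exists_generic ((hf x₀).countable.union (hf' x₀).countable)
    Metric.isOpen_ball ⟨x₀, Metric.mem_ball_self (half_pos hr₀)⟩
  have hr := half_pos hr₀
  set r := r₀ / 2 with hrdef
  have hloc : ∀ p ∈ Metric.closedBall x r, φ (mk Γ p) = mk Γ (g p) := fun p hp =>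
    hloc₀ p (Metric.closedBall_subset_closedBall' (by
      have := Metric.mem_ball.1 hxU
      linarith) hp)
  have hloc' : ∀ p ∈ Metric.closedBall (g x) r, φ.symm (mk Γ p) = mk Γ (g⁻¹ p) := by
    intro p hp
    rw [IsometryEquiv.symm_apply_eq, hloc, apply_inv_apply]
    rwa [Metric.mem_closedBall, ← g.dist_eq, apply_inv_apply]
  refine le_of_voronoi_eq (hf x) (hf' x) hinj fun z => ⟨fun hz γ hγ => ?_, fun hz γ hγ => ?_⟩
  · have := dist_le_of_local_lift hd φ g hr hloc hz hγ
    simpa only [MulAut.conj_apply, MulEquiv.toMonoidHom_eq_coe, MonoidHom.coe_coe, mul_apply,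
      inv_apply_apply, g.dist_eq] using this
  · have hgz : ∀ δ ∈ Γ, dist (g z) (g x) ≤ dist (g z) (δ (g x)) := by
      intro δ hδ
      have := hz (g⁻¹ * δ * g) (by
        rw [hΓ']
        have : g * (g⁻¹ * δ * g) * g⁻¹ = δ := by group
        rwa [this])
      rw [mul_apply, mul_apply, ← g.dist_eq z (g⁻¹ _), apply_inv_apply, ← g.dist_eq] at this
      exact this
    have := dist_le_of_local_lift hd φ.symm g⁻¹ hr hloc' hgz hγ
    rwa [g.dist_eq, inv_apply_apply, inv_apply_apply] at this

/-! ### Isometries of the orbit space near the identity -/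

/-- A point `x` with trivial stabilizer is isolated in its orbit. -/
theorem exists_regular (hd : DiscreteTopology Γ) :
    ∃ x : ESpace n, ∃ r > 0, ∀ γ ∈ Γ, dist x (γ x) < 8 * r → γ = 1 := by
  obtain ⟨x, -, hx⟩ := exists_generic (countable_of_discrete hd) isOpen_univ Set.univ_nonempty
  set T : Set (IsomE n) := {γ | γ ∈ Γ ∧ γ ≠ 1} with hT
  have hf : FiniteAt T x := fun z C =>
    (finite_dist_apply_le hd z x C).subset fun γ hγ => ⟨hγ.1.1, hγ.2⟩
  rcases T.eq_empty_or_nonempty with h0 | hne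
  · refine ⟨x, 1, one_pos, fun γ hγ _ => ?_⟩
    by_contra h
    exact (h0 ▸ (⟨hγ, h⟩ : γ ∈ T) : γ ∈ (∅ : Set (IsomE n)))
  · obtain ⟨γ₀, hγ₀, h0⟩ := hf.exists_infDist_eq hne x
    have hpos : 0 < dist x (γ₀ x) :=
      dist_pos.2 fun h => hγ₀.2 (hx _ hγ₀.1 1 Γ.one_mem h.symm)
    refine ⟨x, dist x (γ₀ x) / 8, by positivity, fun γ hγ hlt => ?_⟩
    by_contra h
    have : Metric.infDist x (orbitSet T x) ≤ dist x (γ x) :=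
      Metric.infDist_le_dist_of_mem (Set.mem_image_of_mem _ ⟨hγ, h⟩)
    rw [h0] at this
    linarith

/-- An isometry of the orbit space near the identity lifts locally at a regular point. -/
theorem exists_local_lift (hd : DiscreteTopology Γ) {x : ESpace n} {r ε : ℝ} (hr : 0 < r)
    (hx : ∀ γ ∈ Γ, dist x (γ x) < 8 * r → γ = 1) (hε : ε ≤ r) (φ : IsomOrbitSpace Γ)
    (hφ : ∀ p, dist (φ p) p < ε) :
    ∃ g : IsomE n, ∀ p ∈ Metric.closedBall x r, φ (mk Γ p) = mk Γ (g p) ∧ dist p (g p) < ε := by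
  have hex : ∀ p : ESpace n, ∃ q, φ (mk Γ p) = mk Γ q ∧ dist p q < ε := by
    intro p
    obtain ⟨q₀, hq₀⟩ := mk_surjective (φ (mk Γ p))
    obtain ⟨γ, hγ, h⟩ := exists_dist_mk_eq hd p q₀
    refine ⟨γ q₀, by rw [mk_apply hγ, hq₀], ?_⟩
    rw [← h, hq₀, dist_comm]
    exact hφ _
  choose f hf hfd using hex
  -- Any `γ ≠ 1` moves `x` at least `8 * r`, so `p` and `γ q` are at least `4 * r ≥ dist p q` apart.
  -- The radius `2 * r` leaves room for `f` to move points of the `r`-ball by less than `r`.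
  have hball : ∀ p q : ESpace n, dist p x ≤ 2 * r → dist q x ≤ 2 * r →
      dist (mk Γ p) (mk Γ q) = dist p q := by
    intro p q hp hq
    refine le_antisymm (dist_mk_mk_le Γ.one_mem p q) ?_
    obtain ⟨γ, hγ, h⟩ := exists_dist_mk_eq hd p q
    rw [h]
    by_cases hlt : dist x (γ x) < 8 * r
    · rw [hx γ hγ hlt]; rfl
    · have h1 := dist_triangle4 x p (γ q) (γ x)
      rw [γ.dist_eq, dist_comm x p] at h1
      have h2 := dist_triangle_right p q x
      linarith
  have hfx : ∀ p ∈ Metric.closedBall x r, dist (f p) x ≤ 2 * r := by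
    intro p hp
    have h1 := dist_triangle_left (f p) x p
    have h2 := hfd p
    rw [Metric.mem_closedBall] at hp
    linarith
  have hiso : ∀ p ∈ Metric.closedBall x r, ∀ q ∈ Metric.closedBall x r,
      dist (f p) (f q) = dist p q := by
    intro p hp q hq
    rw [← hball _ _ (hfx p hp) (hfx q hq), ← hf, ← hf]
    rw [Metric.mem_closedBall] at hp hq
    refine (φ.dist_eq _ _).trans ?_
    exact hball p q (by linarith) (by linarith)
  obtain ⟨g, hg⟩ := exists_isometry_eq_on_closedBall hr hiso
  refine ⟨g, fun p hp => ?_⟩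
  rw [hg p hp]
  exact ⟨hf p, hfd p⟩

theorem norm_linPart_sub_one_le_of_ball {g : IsomE n} {x : ESpace n} {r ε : ℝ} (hr : 0 < r)
    (hε : 0 ≤ ε) (h : ∀ p ∈ Metric.closedBall x r, dist p (g p) ≤ ε) :
    ‖linPart g - 1‖ ≤ 2 * ε / r := by
  refine ContinuousLinearMap.opNorm_le_bound _ (by positivity) fun v => ?_
  rcases eq_or_ne v 0 with rfl | hv
  · simp
  have hv0 : 0 < ‖v‖ := norm_pos_iff.2 hv
  set w := (r / ‖v‖) • v with hw
  have hwn : ‖w‖ = r := by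
    rw [hw, norm_smul, Real.norm_eq_abs, abs_of_pos (by positivity), div_mul_cancel₀ _ hv0.ne']
  have h1 : ‖(linPart g - 1) w‖ ≤ 2 * ε := by
    have e1 : (linPart g - 1) w = (x - g x) - ((x + w) - g (x + w)) := by
      rw [apply_add, sub_apply, one_apply_eq_self]; abel
    have e2 := h x (Metric.mem_closedBall_self hr.le)
    have e3 := h (x + w) (by rw [Metric.mem_closedBall, dist_self_add_left, hwn])
    rw [dist_eq_norm] at e2 e3
    rw [e1]
    linarith [norm_sub_le (x - g x) ((x + w) - g (x + w))]
  rw [hw, map_smul, norm_smul, Real.norm_eq_abs, abs_of_pos (by positivity), div_mul_eq_mul_div,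
    div_le_iff₀ hv0] at h1
  rw [div_mul_eq_mul_div, le_div_iff₀ hr]
  linarith

/-- Compare `g γ g⁻¹ γ⁻¹ 0` with `g γ γ⁻¹ 0 = g 0`. The argument gives the factor `1`; the `3` is
slack. -/
theorem norm_conj_commutator_apply_zero_le (g γ : IsomE n) :
    ‖⁅g, γ⁆ 0‖ ≤ dist (g 0) 0 + 3 * dist (g (γ⁻¹ 0)) (γ⁻¹ 0) := by
  set u := γ⁻¹ 0 with hu
  set w := g⁻¹ u with hw
  have h1 : ⁅g, γ⁆ 0 = g (γ w) := rfl
  have h2 : γ u = 0 := apply_inv_apply γ 0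
  have h3 : dist w u = dist (g u) u := by
    rw [← g.dist_eq, hw, apply_inv_apply, dist_comm]
  have h4 := dist_triangle4 (g (γ w)) (g (γ u)) (γ u) (γ u)
  rw [g.dist_eq, γ.dist_eq, dist_self, h2, h3, ← h1, dist_zero_right] at h4
  have : 0 ≤ dist (g u) u := dist_nonneg
  linarith

/-- If the abelianization of `Γ` is finite then an isometry of the orbit space near the identity is
the identity. -/
theorem exists_isometry_isolation (hΓ : IsSpaceGroup Γ) (hfin : Finite (Γ ⧸ commutator Γ)) :
    ∃ ε > 0, ∀ φ : IsomOrbitSpace Γ, (∀ p, dist (φ p) p < ε) → φ = 1 := by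
  have hd := hΓ.discrete
  obtain ⟨x, r, hr, hx⟩ := exists_regular hd
  obtain ⟨δ, hδ, hiso⟩ := exists_isolation hd
  obtain ⟨S, hS, hSf⟩ := Group.fg_iff.1 (group_fg hΓ)
  obtain ⟨M, hM⟩ := (hSf.image fun γ : Γ => ‖γ.1⁻¹ 0‖).bddAbove
  -- The three terms, times `ε`, bound the displacement of `x`, the deviation of the linear part
  -- from `1`, and its effect on points of norm at most `|M|`.
  set K := 1 + 2 / r + 2 / r * (|M| + ‖x‖) with hK
  have hK0 : 0 < K := by positivity
  refine ⟨min r (δ / (8 * K)), lt_min hr (by positivity), fun φ hφ => ?_⟩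
  set ε := min r (δ / (8 * K)) with hε
  have hε0 : 0 < ε := lt_min hr (by positivity)
  have hεK : ε * K ≤ δ / 8 := by
    have := mul_le_mul_of_nonneg_right (min_le_right r (δ / (8 * K))) hK0.le
    refine this.trans_eq ?_
    field_simp
  obtain ⟨g, hg⟩ := exists_local_lift hd hr hx (min_le_left _ _) φ hφ
  have hloc : ∀ p ∈ Metric.closedBall x r, φ (mk Γ p) = mk Γ (g p) := fun p hp => (hg p hp).1
  have hlin : ‖linPart g - 1‖ ≤ 2 * ε / r :=
    norm_linPart_sub_one_le_of_ball hr hε0.le fun p hp => (hg p hp).2.le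
  have hdisp : ∀ z : ESpace n, ‖z‖ ≤ |M| → dist (g z) z ≤ δ / 8 := by
    intro z hz
    have e1 : g z - z = (linPart g - 1) (z - x) + (g x - x) := by
      rw [sub_apply, one_apply_eq_self, ← apply_sub]; abel
    have e2 := (hg x (Metric.mem_closedBall_self hr.le)).2
    rw [dist_comm, dist_eq_norm] at e2
    have e3 := (linPart g - 1).le_opNorm (z - x)
    have e4 : ‖linPart g - 1‖ * ‖z - x‖ ≤ 2 * ε / r * (|M| + ‖x‖) := by
      gcongr
      exact (norm_sub_le z x).trans (by gcongr)
    rw [dist_eq_norm, e1]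
    refine (norm_add_le _ _).trans (le_trans ?_ hεK)
    have e5 : ε * K = ε + 2 * ε / r + 2 * ε / r * (|M| + ‖x‖) := by rw [hK]; ring
    have e6 : 0 < 2 * ε / r := by positivity
    linarith
  have hconj := conj_mem_of_local_lift hd φ g hr hloc
  have hcomm : ∀ γ ∈ Γ, g * γ = γ * g := by
    -- For a generator `γ`, `[g, γ] = (g γ g⁻¹) γ⁻¹` lies in `Γ` and is small in both norms, hence
    -- is `1` by discreteness.
    have hle : Subgroup.closure S ≤ (Subgroup.centralizer {g}).comap Γ.subtype := by
      rw [Subgroup.closure_le]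
      intro γ hγ
      change γ.1 ∈ Subgroup.centralizer {g}
      rw [Subgroup.mem_centralizer_singleton_iff]
      refine (commutatorElement_eq_one_iff_mul_comm.1 (hiso _ ?_ ?_ ?_)).symm
      · exact Γ.mul_mem (hconj _ γ.2) (Γ.inv_mem γ.2)
      · have e1 : ‖linPart ⁅g, γ.1⁆ - 1‖ ≤ 2 * (2 * ε / r) := by
          rw [linPart_commutator_sub_one, norm_sub_rev, ← linPart_commutator_sub_one]
          exact (norm_linPart_commutator_le_right _ _).trans (by gcongr)
        have e5 : ε * K = ε + 2 * ε / r + 2 * ε / r * (|M| + ‖x‖) := by rw [hK]; ring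
        have e6 : 0 ≤ 2 * ε / r * (|M| + ‖x‖) := by positivity
        linarith
      · have e1 := norm_conj_commutator_apply_zero_le g γ.1
        have e2 := hdisp 0 (by rw [norm_zero]; exact abs_nonneg M)
        have e3 := hdisp (γ.1⁻¹ 0) ((hM (Set.mem_image_of_mem _ hγ)).trans (le_abs_self M))
        linarith
    intro γ hγ
    have : (⟨γ, hγ⟩ : Γ) ∈ (Subgroup.centralizer {g}).comap Γ.subtype :=
      hle (hS ▸ Subgroup.mem_top _)
    exact (Subgroup.mem_centralizer_singleton_iff.1 this).symm
  have hlin1 := linPart_eq_one_of_commute hΓ.compact hcomm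
  have hg0 : g 0 = 0 := eq_zero_of_finite_abelianization hΓ.compact hfin fun γ hγ =>
    linPart_fix_of_commute hlin1 (hcomm γ hγ)
  have hg1 : g = 1 := eq_one_of_linPart hlin1 hg0
  ext1 p
  -- Every orbit meets the cell of `x`, so `g = 1` determines `φ` everywhere.
  obtain ⟨z, rfl, hz⟩ := exists_mem_dirichlet hd x p
  rw [apply_mk_of_dirichlet hd φ g hr hloc hz, hg1]
  rfl

/-- Isometries closer than `ε / 4` on a finite `ε / 4`-net are closer than `ε` everywhere, hence
equal by isolation. Their restrictions to the net lie in a compact finite power of the orbit space.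
-/
theorem finite_isomOrbitSpace (hΓ : IsSpaceGroup Γ) (hfin : Finite (Γ ⧸ commutator Γ)) :
    Finite (IsomOrbitSpace Γ) := by
  obtain ⟨ε, hε, hiso⟩ := exists_isometry_isolation hΓ hfin
  have hc : CompactSpace (OrbitSpace Γ) := hΓ.compact
  obtain ⟨N, -, hNf, hN⟩ := Metric.finite_approx_of_totallyBounded
    (isCompact_univ (X := OrbitSpace Γ)).totallyBounded (ε / 4) (by positivity)
  have := hNf.fintype
  refine finite_of_separated (fun (φ : IsomOrbitSpace Γ) (p : N) => φ p.1)
    (isCompact_univ.totallyBounded.subset (Set.subset_univ _)) (show 0 < ε / 4 by positivity)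
    fun φ ψ h => ?_
  have h1 : ψ⁻¹ * φ = 1 := by
    refine hiso _ fun p => ?_
    obtain ⟨q, hq, hpq⟩ := Set.mem_iUnion₂.1 (hN (Set.mem_univ p))
    rw [Metric.mem_ball] at hpq
    have h2 : dist (φ q) (ψ q) < ε / 4 :=
      (dist_le_pi_dist (fun p : N => φ p.1) (fun p : N => ψ p.1) ⟨q, hq⟩).trans_lt h
    have h3 : dist ((ψ⁻¹ * φ) p) p = dist (φ p) (ψ p) := by
      rw [← ψ.dist_eq]
      congr 1
      exact ψ.apply_symm_apply _
    have h4 := dist_triangle4 (φ p) (φ q) (ψ q) (ψ p)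
    rw [φ.dist_eq, ψ.dist_eq, dist_comm q p] at h4
    rw [h3]
    linarith
  exact (inv_mul_eq_one.1 h1).symm

/-! ### Translations acting on the orbit space -/

/-- The isometry of the orbit space induced by an isometry of `E^n` that commutes with `Γ`. -/
noncomputable def inducedIsometry (Γ : Subgroup (IsomE n)) (g : IsomE n)
    (hg : ∀ γ ∈ Γ, g * γ = γ * g) : IsomOrbitSpace Γ := by
  have hwd : ∀ h : IsomE n, (∀ γ ∈ Γ, h * γ = γ * h) → ∀ x y : ESpace n,
      MulAction.orbitRel Γ (ESpace n) x y → mk Γ (h x) = mk Γ (h y) := by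
    rintro h hh x y ⟨γ, rfl⟩
    refine mk_eq_mk.2 ⟨γ.1, γ.2, ?_⟩
    exact (congrArg (fun k : IsomE n => k y) (hh γ.1 γ.2)).symm
  have hg' : ∀ γ ∈ Γ, g⁻¹ * γ = γ * g⁻¹ := fun γ hγ => by
    rw [inv_mul_eq_iff_eq_mul, ← mul_assoc, hg γ hγ, mul_inv_cancel_right]
  exact
  { toFun := Quotient.lift (fun x => mk Γ (g x)) (hwd g hg)
    invFun := Quotient.lift (fun x => mk Γ (g⁻¹ x)) (hwd g⁻¹ hg')
    left_inv := fun p => by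
      obtain ⟨x, rfl⟩ := mk_surjective p
      exact congrArg (mk Γ) (inv_apply_apply g x)
    right_inv := fun p => by
      obtain ⟨x, rfl⟩ := mk_surjective p
      exact congrArg (mk Γ) (apply_inv_apply g x)
    isometry_toFun := Isometry.of_dist_eq fun p q => by
      obtain ⟨x, rfl⟩ := mk_surjective p
      obtain ⟨y, rfl⟩ := mk_surjective q
      refine eq_of_forall_gt_iff fun c => ?_
      refine (dist_mk_lt_iff (x := g x) (y := g y)).trans (Iff.trans ?_ dist_mk_lt_iff.symm)
      refine exists_congr fun γ => ?_
      have h1 : γ • g y = g (γ • y) :=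
        (congrArg (fun k : IsomE n => k y) (hg γ.1 γ.2)).symm
      rw [h1, g.dist_eq] }

/-- If the isometry group of the orbit space is finite then the point group fixes no nonzero
vector. -/
theorem eq_zero_of_finite_isomOrbitSpace (hd : DiscreteTopology Γ)
    (hfin : Finite (IsomOrbitSpace Γ)) {v : ESpace n} (hv : ∀ γ ∈ Γ, linPart γ v = v) :
    v = 0 := by
  by_contra hne
  have hv0 : 0 < ‖v‖ := norm_pos_iff.2 hne
  obtain ⟨η, hη, hsep⟩ : ∃ η > 0, ∀ γ ∈ Γ, ‖γ 0‖ < η → γ 0 = 0 := by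
    have hf := (finite_norm_apply_zero_le hd 1).image fun γ : IsomE n => γ 0
    have hnhds : ((fun γ : IsomE n => γ 0) '' {γ | γ ∈ Γ ∧ ‖γ 0‖ ≤ 1} \ {0})ᶜ ∈
        𝓝 (0 : ESpace n) := by
      refine (hf.sdiff).isClosed.isOpen_compl.mem_nhds ?_
      simp
    obtain ⟨η, hη, hb⟩ := Metric.mem_nhds_iff.1 hnhds
    refine ⟨min η 1, lt_min hη one_pos, fun γ hγ hlt => ?_⟩
    by_contra h0
    have h1 := hb (mem_ball_zero_iff.2 (hlt.trans_le (min_le_left _ _)))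
    exact h1 ⟨⟨γ, ⟨hγ, (hlt.trans_le (min_le_right _ _)).le⟩, rfl⟩, h0⟩
  have hcomm : ∀ t : ℝ, ∀ γ ∈ Γ,
      (IsometryEquiv.addRight (t • v) : IsomE n) * γ = γ * IsometryEquiv.addRight (t • v) := by
    intro t γ hγ
    ext1 x
    change γ x + t • v = γ (x + t • v)
    rw [apply_add, map_smul, hv γ hγ]
  -- Infinitely many distinct lengths in `(0, η / ‖v‖)`. If two translations induce the same
  -- isometry, some `γ` has `γ 0 = (s k - s l) • v`, shorter than `η`, hence zero.
  set s : ℕ → ℝ := fun k => η / ‖v‖ / (k + 2) with hs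
  have hs0 : ∀ k, 0 < s k := fun k => by positivity
  have hs1 : ∀ k, s k < η / ‖v‖ := fun k => div_lt_self (by positivity) (by
    have : (0 : ℝ) ≤ k := Nat.cast_nonneg k
    linarith)
  obtain ⟨k, l, hkl, heq⟩ := Finite.exists_ne_map_eq_of_infinite fun k : ℕ =>
    inducedIsometry Γ (IsometryEquiv.addRight (s k • v)) (hcomm (s k))
  have h1 : mk Γ (0 + s k • v) = mk Γ (0 + s l • v) :=
    congrArg (fun φ : IsomOrbitSpace Γ => φ (mk Γ 0)) heq
  obtain ⟨γ, hγ, h2⟩ := mk_eq_mk.1 h1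
  rw [apply_add, map_smul, hv γ hγ, zero_add] at h2
  have h3 : γ 0 = (s k - s l) • v := by rw [sub_smul]; exact eq_sub_of_add_eq h2
  have h4 : |s k - s l| < η / ‖v‖ := by
    rw [abs_lt]
    constructor <;> linarith [hs0 k, hs0 l, hs1 k, hs1 l]
  have h5 := hsep γ hγ (by
    rw [h3, norm_smul, Real.norm_eq_abs]
    rwa [lt_div_iff₀ hv0] at h4)
  rw [h3, smul_eq_zero, sub_eq_zero] at h5
  have h6 := h5.resolve_right hne
  simp only [hs] at h6
  have h7 : (η / ‖v‖) ≠ 0 := by positivity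
  rw [div_eq_div_iff (by positivity) (by positivity), mul_right_inj' h7] at h6
  exact hkl (Nat.cast_injective (R := ℝ) (by linarith))

/-- The center of a cocompact group consists of translations by vectors fixed by the point group.
-/
theorem center_eq_bot_of_fixed (hc : CompactSpace (OrbitSpace Γ))
    (h : ∀ v : ESpace n, (∀ γ ∈ Γ, linPart γ v = v) → v = 0) : Subgroup.center Γ = ⊥ := by
  refine (Subgroup.eq_bot_iff_forall _).2 fun ζ hζ => ?_
  have hcomm : ∀ γ ∈ Γ, ζ.1 * γ = γ * ζ.1 := fun γ hγ =>
    (congrArg Subtype.val (Subgroup.mem_center_iff.1 hζ ⟨γ, hγ⟩)).symm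
  have hlin := linPart_eq_one_of_commute hc hcomm
  exact Subtype.ext (eq_one_of_linPart hlin
    (h _ fun γ hγ => linPart_fix_of_commute hlin (hcomm γ hγ)))

end IsomE

theorem corollary5 (n : ℕ) (Γ : Subgroup (IsomE n)) (hΓ : IsSpaceGroup Γ) :
    List.TFAE [
      Finite (IsomOrbitSpace Γ),
      Subgroup.center Γ = ⊥,
      Finite (Γ ⧸ commutator Γ)] := by
  tfae_have 1 → 2 := fun h => IsomE.center_eq_bot_of_fixed hΓ.compact fun _ hv =>
    IsomE.eq_zero_of_finite_isomOrbitSpace hΓ.discrete h hv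
  tfae_have 2 → 3 := by
    intro h
    have := IsomE.finiteIndex_ker_linHom hΓ
    refine finite_abelianization_of_center_eq_bot (IsomE.group_fg hΓ) (IsomE.linHom Γ).ker ?_ h
    exact fun a ha b hb => Subtype.ext (IsomE.commute_of_translation ha hb)
  tfae_have 3 → 1 := IsomE.finite_isomOrbitSpace hΓ
  tfae_finish
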